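/- For a base $x$ let $(a;x)_j=\prod_{k=0}^{j-1}(1-ax^k)$ and, for integers $a\ge 0$ and $b$, let $\binom{a}{b}_x=\frac{(x;x)_a}{(x;x)_b(x;x)_{a-b}}$, which is $0$ unless $0\le b\le a$. (a) For all integers $n,r\ge 0$, the following identity holds in $\mathbb Z[q]$ (in particular, both sides are polynomials in $q$ with integer coefficients): $$q^{\binom r2}\frac{(q^{2n};q^{-2})_r}{(q;q)_r}=\sum_{i=0}^n(-1)^i q^{i^2-i}\binom{n}{i}_{q^2}\binom{2n-2i}{2n-r}_q .$$ When $q$ is a prime power, both sides are equal to the number of $\mathbb F_q$-subspaces $W\subseteq\mathbb F_{q^2}^n$ of $\mathbb F_q$-codimension $r$ such that $\mathbb F_{q^2}\cdot W=\mathbb F_{q^2}^n$. (b) Let $q$ be a prime power, let $R=R'_{2,2}=\mathbb F_q[[T]]+T\,\mathbb F_{q^2}[[T]]$, and let $\widetilde R$ be its normalization, i.e. its integral closure in $\mathbb F_{q^2}((T))$. For every $n\ge 0$, the $R$-module $\widetilde R^n$ has finitely many $R$-submodules of each finite index, and its zeta function $$\zeta^R_{\widetilde R^n}(s)=\sum_{L}(\widetilde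 R^n:L)^{-s},$$ where $L$ ranges over the finite-index $R$-submodules of $\widetilde R^n$, satisfies, as a formal Dirichlet series with $t:=q^{-s}$, $$(q^{-2s};q^2)_n\,\zeta^R_{\widetilde R^n}(s)=\sum_{r=0}^n q^{\binom r2}\frac{(q^{2n};q^{-2})_r}{(q;q)_r}\,t^r .$$ -/

import Mathlib

open scoped PowerSeries LaurentSeries

noncomputable section

/-- The `q`-Pochhammer symbol `(a;q)_n = ∏_{0 ≤ k < n} (1 - a q^k)`. -/
def qPoch {A : Type*} [CommRing A] (a q : A) (n : ℕ) : A :=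
  ∏ k ∈ Finset.range n, (1 - a * q ^ k)

/-- `1 / (q;q)_m` for an integer `m`, with the convention that it is `0` for `m < 0`. -/
def invQPoch {K : Type*} [Field K] (q : K) (m : ℤ) : K :=
  if m < 0 then 0 else (qPoch q q m.toNat)⁻¹

/-- The `q`-binomial coefficient `(q;q)_a / ((q;q)_b (q;q)_{a-b})` for integers `a, b`
(zero unless `0 ≤ b ≤ a`). -/
def qBinom {K : Type*} [Field K] (q : K) (a b : ℤ) : K :=
  qPoch q q a.toNat * invQPoch q b * invQPoch q (a - b)

/-- `q^{binom(r,2)} (q^{2n};q^{-2})_r / (q;q)_r`. -/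
def productSide {K : Type*} [Field K] (q : K) (n r : ℕ) : K :=
  q ^ (r.choose 2) * qPoch (q ^ (2 * n)) ((q ^ 2)⁻¹) r / qPoch q q r

/-- `∑_{i=0}^n (-1)^i q^{i^2-i} [n, i]_{q^2} [2n-2i, 2n-r]_q`. -/
def sumSide {K : Type*} [Field K] (q : K) (n r : ℕ) : K :=
  ∑ i ∈ Finset.range (n + 1), (-1) ^ i * q ^ (i ^ 2 - i) *
    qBinom (q ^ 2) (n : ℤ) (i : ℤ) *
    qBinom q (2 * (n : ℤ) - 2 * (i : ℤ)) (2 * (n : ℤ) - (r : ℤ))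

/-- The `k`-subspaces `W` of `l^n` of `k`-codimension `r` such that `l · W = l^n`. -/
def spanningSubspaces (k l : Type*) [Field k] [Field l] [Algebra k l] (n r : ℕ) :
    Set (Submodule k (Fin n → l)) :=
  {W | Module.finrank k ((Fin n → l) ⧸ W) = r ∧
    Submodule.span l (W : Set (Fin n → l)) = ⊤}

/-- The inert quadratic order `k[[T]] + T^m l[[T]]` (for a quadratic extension `l / k` of finite
fields), as a subring of `l[[T]]`. -/
def inertOrder (k l : Type*) [Field k] [Field l] [Algebra k l] (m : ℕ) : Subring l⟦X⟧ where
  carrier := {f | ∃ (a : k⟦X⟧) (b : l⟦X⟧),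
    f = PowerSeries.map (algebraMap k l) a + PowerSeries.X ^ m * b}
  mul_mem' := by
    rintro _ _ ⟨a, b, rfl⟩ ⟨c, d, rfl⟩
    refine ⟨a * c, PowerSeries.map (algebraMap k l) a * d + b * PowerSeries.map (algebraMap k l) c
      + PowerSeries.X ^ m * b * d, ?_⟩
    rw [map_mul]
    ring
  one_mem' := ⟨1, 0, by simp⟩
  add_mem' := by
    rintro _ _ ⟨a, b, rfl⟩ ⟨c, d, rfl⟩
    refine ⟨a + c, b + d, ?_⟩
    rw [map_add]
    ring
  zero_mem' := ⟨0, 0, by simp⟩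
  neg_mem' := by
    rintro _ ⟨a, b, rfl⟩
    refine ⟨-a, -b, ?_⟩
    rw [map_neg]
    ring

/-- The normalization of the inert order: its integral closure in `l((T))`. -/
abbrev inertNormalization (k l : Type*) [Field k] [Field l] [Algebra k l] (m : ℕ) :
    Subalgebra (inertOrder k l m) l⸨X⸩ :=
  integralClosure (inertOrder k l m) l⸨X⸩

/-- `M` has only finitely many `R`-submodules of any given finite index, that is, the Quot zeta
function of `M` over `R` is well defined. -/
def QuotZetaWellDefined (R M : Type*) [CommRing R] [AddCommGroup M] [Module R M] : Prop :=
  ∀ N : ℕ, N ≠ 0 → {L : Submodule R M | Nat.card (M ⧸ L) = N}.Finite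

/-- The Quot zeta function `ζ_M^R(s) = ∑_L (M:L)^{-s}`, over the finite-index `R`-submodules `L`
of `M`, as a formal Dirichlet series (a sequence of coefficients, multiplied by Dirichlet
convolution). -/
def quotZeta (R M : Type*) [CommRing R] [AddCommGroup M] [Module R M] : ArithmeticFunction ℚ where
  toFun N := if N = 0 then 0 else (Nat.card {L : Submodule R M // Nat.card (M ⧸ L) = N} : ℚ)
  map_zero' := by simp

/-- The formal Dirichlet series with the single term `c · N^{-s}` (for `N ≥ 1`). -/
def dirTerm (c : ℚ) (N : ℕ) : ArithmeticFunction ℚ where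
  toFun j := if j = 0 then 0 else if j = N then c else 0
  map_zero' := by simp

end

/-! Part (a). For q nonzero and not a root of unity, both sides satisfy F(n+1, r+1) = (q^r +
q^(2n+1)) F(n, r) + q^(r+1) F(n, r+1) (`sumSideInt_succ`, `productSide_succ_succ`) and agree at n =
0 and at r = 0. The recurrence also yields the integer polynomial. For the count, orthogonality
under tr(x · y) turns the spanning W of codimension r into the r-dimensional V that contain no
nonzero l-line. Since [l : k] = 2, such a V with a k-basis is the same as an l-independent r-tuple
in l^n (`linearIndependentEquivSigma`), so the number is ∏ (q^(2n) - q^(2i)) / ∏ (q^r - q^i) over i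
< r.

Part (b). The normalization is O = l⟦X⟧. Finite-index R-submodules L of O^n are grouped by the
O-module M = O·L. As M is free of rank n, the L above M correspond to those above O^n, with equal
relative index. Those above O^n contain X·O^n, because X·O ⊆ R, and by Nakayama they are the
preimages of the spanning W ⊆ l^n (`spanTopEquiv`). Hence the zeta function is that of O^n over O
times the polynomial of (a).

The zeta function of O^n is found by induction on n (`quotZeta_prod`): a finite-index submodule of O
× N is given by its kernel M' ⊆ N, its image (g) and a class in N/M'. The |N/M'| choices of class
amount to s ↦ s - 1 in the factor of N, which builds up 1/(t²; q²)_n. -/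

theorem qPoch_succ {A : Type*} [CommRing A] (a q : A) (n : ℕ) :
    qPoch a q (n + 1) = qPoch a q n * (1 - a * q ^ n) :=
  Finset.prod_range_succ _ _

theorem qPoch_succ' {A : Type*} [CommRing A] (a q : A) (n : ℕ) :
    qPoch a q (n + 1) = qPoch (a * q) q n * (1 - a) := by
  simp only [qPoch, Finset.prod_range_succ', pow_zero, mul_one]
  congr 1
  exact Finset.prod_congr rfl fun k _ => by ring

/-! ### The q-binomial identity -/

section Identity

variable {K : Type*} [Field K] {q : K}

theorem qPoch_self_ne_zero (hq : ∀ m : ℕ, m ≠ 0 → q ^ m ≠ 1) (n : ℕ) : qPoch q q n ≠ 0 :=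
  Finset.prod_ne_zero_iff.2 fun k _ h => hq (k + 1) k.succ_ne_zero (by
    rw [pow_succ']; exact (sub_eq_zero.1 h).symm)

/-- Both sides vanish for m ≤ 0, so the Pascal rules derived from this hold for every integer lower
index, without boundary cases. -/
theorem invQPoch_sub_one (hq : ∀ m : ℕ, m ≠ 0 → q ^ m ≠ 1) (m : ℤ) :
    invQPoch q (m - 1) = (1 - q ^ m) * invQPoch q m := by
  rcases lt_trichotomy m 0 with h | rfl | h
  · simp [invQPoch, h, show m - 1 < 0 by omega]
  · simp [invQPoch]
  · obtain ⟨j, rfl⟩ : ∃ j : ℕ, m = j + 1 := ⟨(m - 1).toNat, by omega⟩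
    have h1 : ((j : ℤ) + 1).toNat = j + 1 := by omega
    have h2 := qPoch_self_ne_zero hq (j + 1)
    have h3 := qPoch_self_ne_zero hq j
    simp only [invQPoch, add_sub_cancel_right, h1, Int.toNat_natCast]
    rw [if_neg (by omega), if_neg (by omega)]
    rw [qPoch_succ] at h2 ⊢
    have h4 : q ^ ((j : ℤ) + 1) = q * q ^ j := by
      rw [show (j : ℤ) + 1 = ((j + 1 : ℕ) : ℤ) by push_cast; ring, zpow_natCast, pow_succ']
    have h5 := right_ne_zero_of_mul h2
    rw [h4]
    field_simp

theorem qPoch_toNat_succ {a : ℤ} (ha : 0 ≤ a) :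
    qPoch q q (a + 1).toNat = qPoch q q a.toNat * (1 - q ^ (a + 1)) := by
  lift a to ℕ using ha
  rw [show ((a : ℤ) + 1).toNat = a + 1 by omega, qPoch_succ,
    show (a : ℤ) + 1 = ((a + 1 : ℕ) : ℤ) by push_cast; ring, zpow_natCast, pow_succ',
    Int.toNat_natCast]

theorem qBinom_succ_left (hq0 : q ≠ 0) (hq : ∀ m : ℕ, m ≠ 0 → q ^ m ≠ 1) {a : ℤ} (ha : 0 ≤ a)
    (b : ℤ) : qBinom q (a + 1) b = qBinom q a b + q ^ (a + 1 - b) * qBinom q a (b - 1) := by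
  have h1 := invQPoch_sub_one hq b
  have h2 := invQPoch_sub_one hq (a + 1 - b)
  have h3 : q ^ (a + 1) = q ^ (a + 1 - b) * q ^ b := by rw [← zpow_add₀ hq0]; congr 1; ring
  simp only [qBinom, qPoch_toNat_succ ha, h1, h3]
  rw [show a - b = a + 1 - b - 1 by ring, h2, show a - (b - 1) = a + 1 - b by ring]
  ring

theorem qBinom_succ_left' (hq0 : q ≠ 0) (hq : ∀ m : ℕ, m ≠ 0 → q ^ m ≠ 1) {a : ℤ} (ha : 0 ≤ a)
    (b : ℤ) : qBinom q (a + 1) b = q ^ b * qBinom q a b + qBinom q a (b - 1) := by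
  have h1 := invQPoch_sub_one hq b
  have h2 := invQPoch_sub_one hq (a + 1 - b)
  have h3 : q ^ (a + 1) = q ^ (a + 1 - b) * q ^ b := by rw [← zpow_add₀ hq0]; congr 1; ring
  simp only [qBinom, qPoch_toNat_succ ha, h1, h3]
  rw [show a - b = a + 1 - b - 1 by ring, h2, show a - (b - 1) = a + 1 - b by ring]
  ring

theorem qBinom_of_neg {a b : ℤ} (hb : b < 0) : qBinom q a b = 0 := by
  simp [qBinom, invQPoch, hb]

theorem qBinom_of_lt {a b : ℤ} (hb : a < b) : qBinom q a b = 0 := by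
  simp [qBinom, invQPoch, hb]

/-- Both Pascal rules are mixed so that, for fixed `b`, the upper index `a` enters the coefficients
only through a factor q^a. In `sumSideInt_succ`, where a = 2n - 2i, that dependence on i is
cancelled by q^(2i). -/
theorem qBinom_add_two_left (hq0 : q ≠ 0) (hq : ∀ m : ℕ, m ≠ 0 → q ^ m ≠ 1) {a : ℤ} (ha : 0 ≤ a)
    (b : ℤ) : qBinom q (a + 2) b = qBinom q a b +
      q ^ (a + 1 - b) * (1 + q ^ b) * qBinom q a (b - 1) +
      q ^ (a + 2 - b) * qBinom q a (b - 2) := by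
  rw [show a + 2 = a + 1 + 1 by ring, qBinom_succ_left hq0 hq (by omega : 0 ≤ a + 1),
    qBinom_succ_left hq0 hq ha, qBinom_succ_left' hq0 hq ha (b - 1),
    show b - 1 - 1 = b - 2 by ring]
  have h1 : q ^ (a + 1 + 1 - b) * q ^ (b - 1) = q ^ (a + 1 - b) * q ^ b := by
    rw [← zpow_add₀ hq0, ← zpow_add₀ hq0]; congr 1; ring
  linear_combination qBinom q a (b - 1) * h1

/-- `sumSide` with an integer second index. -/
def sumSideInt (q : K) (n : ℕ) (r : ℤ) : K :=
  ∑ i ∈ Finset.range (n + 1), (-1) ^ i * q ^ (i ^ 2 - i) *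
    qBinom (q ^ 2) (n : ℤ) (i : ℤ) * qBinom q (2 * (n : ℤ) - 2 * (i : ℤ)) (2 * (n : ℤ) - r)

/-- Pascal's rule for the q²-binomial and a shift of the summation index leave differences of two
q-binomials. `qBinom_add_two_left` cancels the leading term of each, and the remaining coefficients
do not depend on i. An integer `r` includes the case r = 0. -/
theorem sumSideInt_succ (hq0 : q ≠ 0) (hq : ∀ m : ℕ, m ≠ 0 → q ^ m ≠ 1) (n : ℕ) (r : ℤ) :
    sumSideInt q (n + 1) r = (q ^ (r - 1) + q ^ (2 * n + 1)) * sumSideInt q n (r - 1) +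
      q ^ r * sumSideInt q n r := by
  have hQ0 : q ^ 2 ≠ 0 := pow_ne_zero 2 hq0
  have hQ : ∀ m : ℕ, m ≠ 0 → (q ^ 2) ^ m ≠ 1 := fun m hm => by
    rw [← pow_mul]; exact hq _ (by omega)
  have key : sumSideInt q (n + 1) r = ∑ i ∈ Finset.range (n + 1), (-1) ^ i * q ^ (i ^ 2 - i) *
      qBinom (q ^ 2) (n : ℤ) (i : ℤ) * (q ^ (2 * i) *
        (qBinom q (2 * (n : ℤ) - 2 * i + 2) (2 * (n : ℤ) + 2 - r) -
          qBinom q (2 * (n : ℤ) - 2 * i) (2 * (n : ℤ) + 2 - r))) := by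
    simp only [sumSideInt, Nat.cast_add, Nat.cast_one,
      qBinom_succ_left' hQ0 hQ (Int.natCast_nonneg n), mul_add, add_mul, Finset.sum_add_distrib]
    rw [Finset.sum_range_succ, Finset.sum_range_succ' _ (n + 1)]
    -- The end terms of the two sums, at i = n + 1 and at i = 0 respectively, vanish.
    rw [qBinom_of_lt (a := n) (b := ((n + 1 : ℕ) : ℤ)) (by push_cast; omega),
      qBinom_of_neg (a := n) (b := ((0 : ℕ) : ℤ) - 1) (by simp)]
    simp only [mul_zero, zero_mul, add_zero]
    rw [← Finset.sum_add_distrib]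
    refine Finset.sum_congr rfl fun i _ => ?_
    have e1 : (i + 1) ^ 2 - (i + 1) = (i ^ 2 - i) + 2 * i := by
      have : i ≤ i ^ 2 := Nat.le_self_pow two_ne_zero i
      zify [this, Nat.le_self_pow two_ne_zero (i + 1)]
      ring
    rw [e1, zpow_natCast, pow_add, ← pow_mul]
    push_cast
    rw [add_sub_cancel_right, show 2 * (n : ℤ) + 2 - 2 * i = 2 * n - 2 * i + 2 by ring,
      show 2 * (n : ℤ) + 2 - 2 * (i + 1) = 2 * n - 2 * i by ring]
    ring
  rw [key]
  simp only [sumSideInt]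
  rw [Finset.mul_sum, Finset.mul_sum, ← Finset.sum_add_distrib]
  refine Finset.sum_congr rfl fun i hi => ?_
  have hi' : i ≤ n := Nat.lt_succ_iff.1 (Finset.mem_range.1 hi)
  rw [qBinom_add_two_left hq0 hq (by omega),
    show 2 * (n : ℤ) + 2 - r - 1 = 2 * n - (r - 1) by ring,
    show 2 * (n : ℤ) + 2 - r - 2 = 2 * n - r by ring]
  have h1 : q ^ (2 * i) * q ^ (2 * (n : ℤ) - 2 * i + 1 - (2 * n + 2 - r)) = q ^ (r - 1) := by
    rw [← zpow_natCast, ← zpow_add₀ hq0]; congr 1; push_cast; ring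
  have h2 : q ^ (2 * i) * q ^ (2 * (n : ℤ) - 2 * i + 2 - (2 * n + 2 - r)) = q ^ r := by
    rw [← zpow_natCast, ← zpow_add₀ hq0]; congr 1; push_cast; ring
  have h3 : q ^ (r - 1) * q ^ (2 * (n : ℤ) + 2 - r) = q ^ (2 * n + 1) := by
    rw [← zpow_natCast, ← zpow_add₀ hq0]; congr 1; push_cast; ring
  rw [← h3, ← h1, ← h2]
  ring

theorem sumSideInt_of_neg (n : ℕ) {r : ℤ} (hr : r < 0) : sumSideInt q n r = 0 :=
  Finset.sum_eq_zero fun i _ => by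
    rw [qBinom_of_lt (a := 2 * (n : ℤ) - 2 * i) (by omega), mul_zero]

theorem sumSide_zero (r : ℕ) : sumSide q 0 r = if r = 0 then 1 else 0 := by
  split_ifs with h
  · subst h
    simp [sumSide, qBinom, invQPoch, qPoch]
  · have : -(r : ℤ) < 0 := by omega
    simp [sumSide, qBinom_of_neg this]

theorem sumSide_succ_zero (hq0 : q ≠ 0) (hq : ∀ m : ℕ, m ≠ 0 → q ^ m ≠ 1) (n : ℕ) :
    sumSide q (n + 1) 0 = sumSide q n 0 := by
  have := sumSideInt_succ hq0 hq n 0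
  rw [sumSideInt_of_neg n (by norm_num : (0 : ℤ) - 1 < 0), mul_zero, zero_add, zpow_zero,
    one_mul] at this
  exact this

theorem sumSide_succ_succ (hq0 : q ≠ 0) (hq : ∀ m : ℕ, m ≠ 0 → q ^ m ≠ 1) (n r : ℕ) :
    sumSide q (n + 1) (r + 1) = (q ^ r + q ^ (2 * n + 1)) * sumSide q n r +
      q ^ (r + 1) * sumSide q n (r + 1) := by
  have := sumSideInt_succ hq0 hq n ((r + 1 : ℕ) : ℤ)
  rwa [zpow_natCast, show ((r + 1 : ℕ) : ℤ) - 1 = (r : ℤ) by push_cast; ring,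
    zpow_natCast] at this

theorem productSide_zero_right (n : ℕ) : productSide q n 0 = 1 := by
  simp [productSide, qPoch]

theorem productSide_of_lt (hq0 : q ≠ 0) {n r : ℕ} (h : n < r) : productSide q n r = 0 := by
  have : qPoch (q ^ (2 * n)) ((q ^ 2)⁻¹) r = 0 :=
    Finset.prod_eq_zero (Finset.mem_range.2 h) (by
      rw [inv_pow, ← pow_mul, mul_inv_cancel₀ (pow_ne_zero _ hq0), sub_self])
  simp [productSide, this]

/-- All three terms are multiples of (q^(2n); q⁻²)_r: one symbol gains a factor at its head, another
at its tail. After dividing it out, a rational identity in q, q^r and q^n remains. -/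
theorem productSide_succ_succ (hq0 : q ≠ 0) (hq : ∀ m : ℕ, m ≠ 0 → q ^ m ≠ 1) (n r : ℕ) :
    productSide q (n + 1) (r + 1) = (q ^ r + q ^ (2 * n + 1)) * productSide q n r +
      q ^ (r + 1) * productSide q n (r + 1) := by
  have h0 := qPoch_self_ne_zero hq r
  have h1 : 1 - q * q ^ r ≠ 0 := fun h => hq (r + 1) r.succ_ne_zero (by
    rw [pow_succ']; exact (sub_eq_zero.1 h).symm)
  have e1 : q ^ (2 * (n + 1)) * (q ^ 2)⁻¹ = q ^ (2 * n) := by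
    rw [mul_add, pow_add, mul_one, mul_assoc, mul_inv_cancel₀ (pow_ne_zero 2 hq0), mul_one]
  simp only [productSide]
  rw [qPoch_succ', e1, qPoch_succ (q ^ (2 * n)), qPoch_succ q, Nat.choose_succ_succ' r 1,
    Nat.choose_one_right, inv_pow, pow_add]
  generalize qPoch (q ^ (2 * n)) (q ^ 2)⁻¹ r = A
  have h2 : q ^ r ≠ 0 := pow_ne_zero _ hq0
  rw [pow_right_comm q 2 r]
  simp only [pow_add, pow_one, mul_add, mul_one] at h1 ⊢
  generalize q ^ r = u at h1 h2 ⊢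
  rw [mul_comm q u] at h1 ⊢
  field_simp
  ring

theorem sumSide_eq_productSide (hq0 : q ≠ 0) (hq : ∀ m : ℕ, m ≠ 0 → q ^ m ≠ 1) (n r : ℕ) :
    sumSide q n r = productSide q n r := by
  induction n generalizing r with
  | zero =>
    rw [sumSide_zero]
    split_ifs with h
    · rw [h, productSide_zero_right]
    · rw [productSide_of_lt hq0 (Nat.pos_of_ne_zero h)]
  | succ n ih =>
    cases r with
    | zero => rw [sumSide_succ_zero hq0 hq, ih, productSide_zero_right, productSide_zero_right]
    | succ r => rw [sumSide_succ_succ hq0 hq, ih, ih, productSide_succ_succ hq0 hq]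

/-- Integrality is hidden by the quotient but evident from the recurrence, whose coefficients are
polynomials in q. -/
theorem exists_aeval_eq_productSide [Algebra ℤ K] (hq0 : q ≠ 0)
    (hq : ∀ m : ℕ, m ≠ 0 → q ^ m ≠ 1) (n r : ℕ) :
    ∃ P : Polynomial ℤ, Polynomial.aeval q P = productSide q n r := by
  induction n generalizing r with
  | zero =>
    cases r with
    | zero => exact ⟨1, by simp [productSide_zero_right]⟩
    | succ r => exact ⟨0, by simp [productSide_of_lt hq0 r.succ_pos]⟩
  | succ n ih =>
    cases r with
    | zero => exact ⟨1, by simp [productSide_zero_right]⟩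
    | succ r =>
      obtain ⟨A, hA⟩ := ih r
      obtain ⟨B, hB⟩ := ih (r + 1)
      exact ⟨(.X ^ r + .X ^ (2 * n + 1)) * A + .X ^ (r + 1) * B, by
        simp [hA, hB, productSide_succ_succ hq0 hq]⟩

end Identity

theorem RatFunc.X_pow_ne_one {K : Type*} [Field K] {m : ℕ} (hm : m ≠ 0) :
    (RatFunc.X : RatFunc K) ^ m ≠ 1 := by
  rw [← RatFunc.algebraMap_X, ← map_pow, ← map_one (algebraMap (Polynomial K) (RatFunc K))]
  intro h
  have := congrArg Polynomial.natDegree (RatFunc.algebraMap_injective K h)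
  simp at this
  exact hm this

/-! ### Line-free subspaces and independent tuples -/

section Spanning

open Module

variable {k l : Type*} [Field k] [Field l] [Algebra k l]

theorem exists_forall_eq_add_mul (h2 : finrank k l = 2) :
    ∃ w : l, ∀ z : l, ∃ a b : k, z = algebraMap k l a + algebraMap k l b * w := by
  have : Module.Finite k l := finite_of_finrank_pos (by omega)
  obtain ⟨w, hw⟩ : ∃ w : l, w ∉ Submodule.span k {(1 : l)} := by
    by_contra! h
    have := finrank_span_singleton (K := k) (one_ne_zero (α := l))
    rw [(Submodule.eq_top_iff'.2 h : Submodule.span k {(1 : l)} = ⊤), finrank_top, h2] at this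
    omega
  have hli : LinearIndependent k ![(1 : l), w] := by
    rw [LinearIndependent.pair_iff' one_ne_zero]
    intro a ha
    exact hw (Submodule.mem_span_singleton.2 ⟨a, ha⟩)
  refine ⟨w, fun z => ?_⟩
  have hz : z ∈ Submodule.span k (Set.range ![(1 : l), w]) := by
    rw [hli.span_eq_top_of_card_eq_finrank' (by simp [h2])]
    trivial
  rw [Matrix.range_cons, Matrix.range_cons, Matrix.range_empty, Set.union_empty,
    Set.singleton_union, Submodule.mem_span_pair] at hz
  obtain ⟨a, b, h⟩ := hz
  exact ⟨a, b, by rw [← h, Algebra.smul_def, Algebra.smul_def, mul_one]⟩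

variable {E : Type*} [AddCommGroup E] [Module l E] [Module k E] [IsScalarTower k l E]

/-- In a `k`-subspace containing no nonzero `l`-line, `k`-independent families are
`l`-independent. -/
theorem linearIndependent_of_forall_smul_mem (h2 : finrank k l = 2) {V : Submodule k E}
    (hV : ∀ y : E, (∀ c : l, c • y ∈ V) → y = 0) {ι : Type*} [Fintype ι] {v : ι → E}
    (hv : LinearIndependent k v) (hvV : ∀ i, v i ∈ V) : LinearIndependent l v := by
  obtain ⟨w, hw⟩ := exists_forall_eq_add_mul h2
  rw [Fintype.linearIndependent_iff]
  intro c hc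
  choose a b hab using fun i => hw (c i)
  have hsum : ∑ i, a i • v i + w • ∑ i, b i • v i = 0 := by
    rw [← hc, Finset.smul_sum, ← Finset.sum_add_distrib]
    refine Finset.sum_congr rfl fun i _ => ?_
    rw [hab i, add_smul, algebraMap_smul, mul_comm, mul_smul, algebraMap_smul]
  have hx : ∑ i, a i • v i ∈ V := V.sum_mem fun i _ => V.smul_mem _ (hvV i)
  have hy : ∑ i, b i • v i ∈ V := V.sum_mem fun i _ => V.smul_mem _ (hvV i)
  -- With x = ∑ aᵢvᵢ and y = ∑ bᵢvᵢ in V, the relation x + w y = 0 puts w y in V as well. So V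
  -- contains the l-line of y, which forces y = 0.
  have hy0 : ∑ i, b i • v i = 0 := by
    refine hV _ fun z => ?_
    obtain ⟨s, t, rfl⟩ := hw z
    rw [add_smul, mul_smul, algebraMap_smul, algebraMap_smul, eq_neg_of_add_eq_zero_right hsum]
    exact V.add_mem (V.smul_mem _ hy) (V.smul_mem _ (V.neg_mem hx))
  rw [hy0, smul_zero, add_zero] at hsum
  intro i
  rw [hab i, Fintype.linearIndependent_iff.1 hv a hsum i,
    Fintype.linearIndependent_iff.1 hv b hy0 i]
  simp

/-- If y and w y have k-coordinates aᵢ and bᵢ in an l-independent family, then w aᵢ = bᵢ. For w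
outside k this forces every aᵢ to vanish. -/
theorem eq_zero_of_forall_smul_mem_span (h2 : finrank k l = 2) {ι : Type*} [Fintype ι] {v : ι → E}
    (hv : LinearIndependent l v) {y : E}
    (hy : ∀ c : l, c • y ∈ Submodule.span k (Set.range v)) : y = 0 := by
  obtain ⟨w, hw⟩ : ∃ w : l, w ∉ Set.range (algebraMap k l) := by
    by_contra! h
    have h1 : finrank k (⊥ : Subalgebra k l) = 1 := Subalgebra.finrank_bot
    rw [(Algebra.surjective_algebraMap_iff.1 h).symm, subalgebra_top_finrank_eq_submodule_top_finrank,
      finrank_top, h2] at h1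
    omega
  obtain ⟨a, ha⟩ := (Submodule.mem_span_range_iff_exists_fun k).1 (hy 1)
  obtain ⟨b, hb⟩ := (Submodule.mem_span_range_iff_exists_fun k).1 (hy w)
  rw [one_smul] at ha
  have h0 : ∑ i, (w * algebraMap k l (a i) - algebraMap k l (b i)) • v i = 0 := by
    simp only [sub_smul, mul_smul, algebraMap_smul, Finset.sum_sub_distrib, ← Finset.smul_sum]
    rw [ha, hb, sub_self]
  have h := Fintype.linearIndependent_iff.1 hv _ h0
  have ha0 : ∀ i, a i = 0 := fun i => by
    by_contra hai
    have hai' : algebraMap k l (a i) ≠ 0 := (map_ne_zero _).2 hai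
    refine hw ⟨b i / a i, ?_⟩
    rw [map_div₀, div_eq_iff hai']
    exact (sub_eq_zero.1 (h i)).symm
  rw [← ha]
  simp [ha0]

/-- The `k`-subspaces of dimension `r` that contain no nonzero `l`-line. -/
def lineFreeSubspaces (k l E : Type*) [Field k] [Field l] [AddCommGroup E]
    [Module l E] [Module k E] (r : ℕ) : Set (Submodule k E) :=
  {V | finrank k V = r ∧ ∀ y : E, (∀ c : l, c • y ∈ V) → y = 0}

/-- An `l`-independent family of length `r` is a line-free subspace together with a `k`-basis. -/
def linearIndependentEquivSigma [Module.Finite k E] (h2 : finrank k l = 2) (r : ℕ) :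
    {v : Fin r → E // LinearIndependent l v} ≃
      Σ V : lineFreeSubspaces k l E r, {v : Fin r → V.1 // LinearIndependent k v} where
  toFun v := ⟨⟨Submodule.span k (Set.range v.1), by
      have := v.2.restrict_scalars' k
      rw [finrank_span_eq_card this, Fintype.card_fin], fun _ hy =>
        eq_zero_of_forall_smul_mem_span h2 v.2 hy⟩,
    ⟨fun i => ⟨v.1 i, Submodule.subset_span ⟨i, rfl⟩⟩, by
      have := v.2.restrict_scalars' k
      exact LinearIndependent.of_comp (Submodule.subtype _) this⟩⟩
  invFun p := ⟨fun i => (p.2.1 i : E), linearIndependent_of_forall_smul_mem h2 p.1.2.2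
    (p.2.2.map' p.1.1.subtype (Submodule.ker_subtype _)) fun i => (p.2.1 i).2⟩
  left_inv v := rfl
  right_inv p := by
    -- Equality of dependent pairs is tested on the subspace and on the vectors in the ambient
    -- space, which avoids transport along an equality of subspaces.
    have hext : ∀ p p' : (Σ V : lineFreeSubspaces k l E r,
        {v : Fin r → V.1 // LinearIndependent k v}), p.1.1 = p'.1.1 →
        (∀ i, (p.2.1 i : E) = p'.2.1 i) → p = p' := by
      rintro ⟨⟨V, hV⟩, v, hv⟩ ⟨⟨V', hV'⟩, v', hv'⟩ h h'
      dsimp only at h h'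
      subst h
      obtain rfl : v = v' := funext fun i => Subtype.ext (h' i)
      rfl
    refine hext _ _ ?_ fun i => rfl
    have h1 := p.2.2.map' p.1.1.subtype (Submodule.ker_subtype _)
    refine Submodule.eq_of_le_of_finrank_eq (Submodule.span_le.2 ?_) ?_
    · rintro _ ⟨i, rfl⟩
      exact (p.2.1 i).2
    · exact ((finrank_span_eq_card h1).trans (Fintype.card_fin r)).trans p.1.2.1.symm

/-- Double count of l-independent r-tuples: each line-free V of dimension r accounts for as many of
them as it has ordered k-bases. -/
theorem card_lineFreeSubspaces_mul [Finite k] [Finite E] (h2 : finrank k l = 2) (r : ℕ)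
    (hr : r ≤ finrank l E) :
    (lineFreeSubspaces k l E r).ncard * ∏ i : Fin r, (Nat.card k ^ r - Nat.card k ^ i.val) =
      ∏ i : Fin r, (Nat.card l ^ finrank l E - Nat.card l ^ i.val) := by
  have : Module.Finite k l := finite_of_finrank_pos (by omega)
  have : Finite l := Module.finite_of_finite k
  have := Fintype.ofFinite k
  have := Fintype.ofFinite l
  have := Fintype.ofFinite (lineFreeSubspaces k l E r)
  have h := Nat.card_congr (linearIndependentEquivSigma (E := E) h2 r)
  rw [Nat.card_sigma, card_linearIndependent hr] at h
  rw [Nat.card_eq_fintype_card (α := l), h, Finset.sum_congr rfl fun V _ => by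
    rw [card_linearIndependent (le_of_eq V.2.1.symm), V.2.1], Finset.sum_const, smul_eq_mul,
    Finset.card_univ, ← Nat.card_coe_set_eq, Nat.card_eq_fintype_card (α := k),
    Nat.card_eq_fintype_card]

end Spanning

/-! ### Trace duality and the number of spanning subspaces -/

section SpanningCount

open Module

variable (k l : Type*) [Field k] [Field l] [Algebra k l]

/-- The `k`-bilinear form `(x, y) ↦ tr (x ⬝ᵥ y)` on `l^n`. -/
noncomputable def traceDotForm (n : ℕ) : LinearMap.BilinForm k (Fin n → l) :=
  LinearMap.mk₂ k (fun x y => Algebra.trace k l (x ⬝ᵥ y))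
    (fun x x' y => by rw [add_dotProduct, map_add])
    (fun c x y => by rw [smul_dotProduct, map_smul])
    (fun x y y' => by rw [dotProduct_add, map_add])
    (fun c x y => by rw [dotProduct_smul, map_smul])

theorem traceDotForm_apply (n : ℕ) (x y : Fin n → l) :
    traceDotForm k l n x y = Algebra.trace k l (x ⬝ᵥ y) := rfl

theorem traceDotForm_isSymm (n : ℕ) : (traceDotForm k l n).IsSymm :=
  ⟨fun x y => by simp [traceDotForm_apply, dotProduct_comm]⟩

variable {k l}

theorem eq_zero_of_trace_mul_eq_zero [FiniteDimensional k l] [Algebra.IsSeparable k l] {z : l}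
    (h : ∀ c : l, Algebra.trace k l (c * z) = 0) : z = 0 :=
  (traceForm_nondegenerate k l).2 z fun c => h c

variable (k l)

theorem traceDotForm_nondegenerate [FiniteDimensional k l] [Algebra.IsSeparable k l] (n : ℕ) :
    (traceDotForm k l n).Nondegenerate := by
  refine (traceDotForm_isSymm k l n).isRefl.nondegenerate_iff_separatingRight.2 fun y hy => ?_
  ext i
  refine eq_zero_of_trace_mul_eq_zero (k := k) fun c => ?_
  have := hy (Pi.single i c)
  rwa [traceDotForm_apply, single_dotProduct] at this

/-- By nondegeneracy of the trace, the l-line of y is trace-orthogonal to W exactly when x · y = 0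
for all x in W. A nonzero such y is a nonzero l-linear functional that kills the l-span of W. -/
theorem span_eq_top_iff_orthogonal [FiniteDimensional k l] [Algebra.IsSeparable k l] {n : ℕ}
    (W : Submodule k (Fin n → l)) :
    Submodule.span l (W : Set (Fin n → l)) = ⊤ ↔
      ∀ y, (∀ c : l, c • y ∈ (traceDotForm k l n).orthogonal W) → y = 0 := by
  have key : ∀ y, (∀ c : l, c • y ∈ (traceDotForm k l n).orthogonal W) ↔
      ∀ x ∈ W, x ⬝ᵥ y = 0 := by
    intro y
    simp only [LinearMap.BilinForm.mem_orthogonal_iff, traceDotForm_apply, dotProduct_smul, smul_eq_mul]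
    exact ⟨fun h x hx => eq_zero_of_trace_mul_eq_zero fun c => h c x hx,
      fun h c x hx => by rw [h x hx, mul_zero, map_zero]⟩
  simp only [key]
  constructor
  · intro h y hy
    have : ∀ x ∈ Submodule.span l (W : Set (Fin n → l)), x ⬝ᵥ y = 0 := fun x hx => by
      induction hx using Submodule.span_induction with
      | mem x hx => exact hy x hx
      | zero => exact zero_dotProduct y
      | add x x' _ _ h h' => rw [add_dotProduct, h, h', add_zero]
      | smul c x _ h => rw [smul_dotProduct, h, smul_zero]
    ext i
    simpa using this (Pi.single i 1) (h ▸ trivial)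
  · intro h
    by_contra hne
    -- A proper l-subspace lies in the kernel of a nonzero functional, and every functional on l^n
    -- is a dot product with a fixed vector.
    obtain ⟨f, hf, hf'⟩ := Submodule.exists_le_ker_of_lt_top _ (lt_top_iff_ne_top.2 hne)
    have hfy : ∀ x, f x = x ⬝ᵥ fun i => f (Pi.single i 1) := fun x => by
      conv_lhs => rw [pi_eq_sum_univ' x]
      simp [dotProduct]
    have h0 := h (fun i => f (Pi.single i 1)) fun x hx => by
      rw [← hfy]
      exact hf' (Submodule.subset_span hx)
    refine hf (LinearMap.ext fun x => ?_)
    rw [hfy, h0, dotProduct_zero, LinearMap.zero_apply]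

/-- The orthogonal complement is an involution that exchanges dimension and codimension. -/
theorem ncard_spanningSubspaces_eq [FiniteDimensional k l] [Algebra.IsSeparable k l] (n r : ℕ) :
    (spanningSubspaces k l n r).ncard = (lineFreeSubspaces k l (Fin n → l) r).ncard := by
  have hB := traceDotForm_nondegenerate k l n
  have hB' := (traceDotForm_isSymm k l n).isRefl
  have hinv := LinearMap.BilinForm.orthogonal_orthogonal hB hB'
  have hrank : ∀ W, finrank k ((traceDotForm k l n).orthogonal W) =
      finrank k ((Fin n → l) ⧸ W) := fun W => by
    have := W.finrank_quotient_add_finrank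
    rw [LinearMap.BilinForm.finrank_orthogonal hB]
    omega
  refine Set.ncard_congr (fun W _ => (traceDotForm k l n).orthogonal W) ?_ ?_ ?_
  · rintro W ⟨h, h'⟩
    exact ⟨(hrank W).trans h, (span_eq_top_iff_orthogonal k l W).1 h'⟩
  · intro W W' _ _ h
    rw [← hinv W, h, hinv]
  · rintro V ⟨h, h'⟩
    refine ⟨(traceDotForm k l n).orthogonal V, ⟨?_, ?_⟩, hinv V⟩
    · rw [← hrank, hinv, h]
    · rwa [span_eq_top_iff_orthogonal, hinv]

/-- Extract -q^(2i) from each factor on the left and -q^i from each factor on the right. The signs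
cancel, and the surplus power of q is q^(r choose 2). -/
theorem prod_pow_sub_pow_eq_productSide {K : Type*} [Field K] {q : K} (hq0 : q ≠ 0)
    (hq : ∀ m : ℕ, m ≠ 0 → q ^ m ≠ 1) (n r : ℕ) :
    ∏ i ∈ Finset.range r, ((q ^ 2) ^ n - (q ^ 2) ^ i) =
      productSide q n r * ∏ i ∈ Finset.range r, (q ^ r - q ^ i) := by
  have hsum : ∑ i ∈ Finset.range r, i = r.choose 2 := by
    rw [Finset.sum_range_id, Nat.choose_two_right]
  have hneg : (-1 : K) ^ r = ∏ _i ∈ Finset.range r, -1 := by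
    rw [Finset.prod_const, Finset.card_range]
  have h1 : ∏ i ∈ Finset.range r, ((q ^ 2) ^ n - (q ^ 2) ^ i) =
      (-1) ^ r * (q ^ 2) ^ r.choose 2 * qPoch (q ^ (2 * n)) (q ^ 2)⁻¹ r := by
    rw [← hsum, ← Finset.prod_pow_eq_pow_sum, qPoch]
    rw [hneg, ← Finset.prod_mul_distrib, ← Finset.prod_mul_distrib]
    refine Finset.prod_congr rfl fun i _ => ?_
    have : (q ^ 2) ^ i ≠ 0 := pow_ne_zero _ (pow_ne_zero _ hq0)
    rw [inv_pow, pow_mul]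
    field_simp
    ring
  have h2 : ∏ i ∈ Finset.range r, (q ^ r - q ^ i) = (-1) ^ r * q ^ r.choose 2 * qPoch q q r := by
    rw [← hsum, ← Finset.prod_pow_eq_pow_sum, qPoch,
      ← Finset.prod_range_reflect (fun i => 1 - q * q ^ i)]
    rw [hneg, ← Finset.prod_mul_distrib, ← Finset.prod_mul_distrib]
    refine Finset.prod_congr rfl fun i hi => ?_
    have : q ^ r = q ^ i * (q * q ^ (r - 1 - i)) := by
      rw [← pow_succ', ← pow_add]
      congr 1
      have := Finset.mem_range.1 hi
      omega
    rw [this]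
    ring
  rw [h1, h2, productSide]
  have h3 := qPoch_self_ne_zero hq r
  rw [pow_right_comm q 2]
  field_simp

theorem ncard_spanningSubspaces [Finite k] {q : ℕ} (hk : Nat.card k = q) (h2 : finrank k l = 2)
    (n r : ℕ) : ((spanningSubspaces k l n r).ncard : ℚ) = productSide (q : ℚ) n r := by
  have : Module.Finite k l := finite_of_finrank_pos (by omega)
  have : Finite l := Module.finite_of_finite k
  have hq1 : 1 < q := hk ▸ Finite.one_lt_card
  have hq0 : (q : ℚ) ≠ 0 := by positivity
  have hq : ∀ m : ℕ, m ≠ 0 → (q : ℚ) ^ m ≠ 1 := fun m hm =>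
    (one_lt_pow₀ (by exact_mod_cast hq1) hm).ne'
  have hl : Nat.card l = q ^ 2 := by rw [Module.natCard_eq_pow_finrank (K := k), hk, h2]
  rw [ncard_spanningSubspaces_eq]
  rcases le_or_gt r n with hr | hr
  · have h := card_lineFreeSubspaces_mul (k := k) (l := l) (E := Fin n → l) h2 r (by simpa)
    rw [hk, hl, finrank_fin_fun, Fin.prod_univ_eq_prod_range (fun i => q ^ r - q ^ i),
      Fin.prod_univ_eq_prod_range (fun i => (q ^ 2) ^ n - (q ^ 2) ^ i)] at h
    have h' := congrArg (Nat.cast (R := ℚ)) h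
    have hlt : ∀ i ∈ Finset.range r, q ^ i < q ^ r := fun i hi =>
      Nat.pow_lt_pow_right hq1 (Finset.mem_range.1 hi)
    have e1 : ∀ i ∈ Finset.range r, ((q ^ r - q ^ i : ℕ) : ℚ) = (q : ℚ) ^ r - (q : ℚ) ^ i :=
      fun i hi => by rw [Nat.cast_sub (hlt i hi).le, Nat.cast_pow, Nat.cast_pow]
    have e2 : ∀ i ∈ Finset.range r, (((q ^ 2) ^ n - (q ^ 2) ^ i : ℕ) : ℚ) =
        ((q : ℚ) ^ 2) ^ n - ((q : ℚ) ^ 2) ^ i := fun i hi => by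
      rw [Nat.cast_sub (Nat.pow_le_pow_right (by positivity)
        ((Finset.mem_range.1 hi).le.trans hr))]
      push_cast
      rfl
    rw [Nat.cast_mul, Nat.cast_prod, Nat.cast_prod, Finset.prod_congr rfl e1,
      Finset.prod_congr rfl e2, prod_pow_sub_pow_eq_productSide hq0 hq] at h'
    refine mul_right_cancel₀ (Finset.prod_ne_zero_iff.2 fun i hi => ?_) h'
    exact (sub_pos.2 (by exact_mod_cast hlt i hi : (q : ℚ) ^ i < (q : ℚ) ^ r)).ne'
  · rw [productSide_of_lt hq0 hr, Nat.cast_eq_zero]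
    refine (congrArg Set.ncard (Set.eq_empty_of_forall_notMem fun V hV => ?_)).trans
      (Set.ncard_empty _)
    -- For r > n, a k-basis of a line-free V would be r vectors of l^n independent over l.
    have hli := linearIndependent_of_forall_smul_mem h2 hV.2
      ((finBasis k V).linearIndependent.map' V.subtype (Submodule.ker_subtype _))
      fun i => (finBasis k V i).2
    have := hli.fintype_card_le_finrank
    rw [Fintype.card_fin, hV.1, finrank_fin_fun] at this
    omega

end SpanningCount

/-! ### Formal Dirichlet series -/

section Dirichlet

theorem dirTerm_apply (c : ℚ) (N j : ℕ) :
    dirTerm c N j = if j = 0 then 0 else if j = N then c else 0 := rfl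

theorem dirTerm_mul_apply (c : ℚ) {M : ℕ} (hM : M ≠ 0) (f : ArithmeticFunction ℚ) (N : ℕ) :
    (dirTerm c M * f) N = if M ∣ N then c * f (N / M) else 0 := by
  rcases eq_or_ne N 0 with rfl | hN
  · simp
  rw [ArithmeticFunction.mul_apply]
  split_ifs with h
  · rw [Finset.sum_eq_single (M, N / M)]
    · simp [dirTerm_apply, hM]
    · rintro ⟨a, b⟩ hab hne
      obtain ⟨rfl, -⟩ := Nat.mem_divisorsAntidiagonal.1 hab
      have : a ≠ M := by
        rintro rfl
        exact hne (by rw [Nat.mul_div_cancel_left _ (Nat.pos_of_ne_zero hM)])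
      simp [dirTerm_apply, this]
    · intro hmem
      exact absurd (Nat.mem_divisorsAntidiagonal.2 ⟨Nat.mul_div_cancel' h, hN⟩) hmem
  · refine Finset.sum_eq_zero ?_
    rintro ⟨a, b⟩ hab
    obtain ⟨rfl, -⟩ := Nat.mem_divisorsAntidiagonal.1 hab
    have : a ≠ M := by
      rintro rfl
      exact h (dvd_mul_right _ _)
    simp [dirTerm_apply, this]

theorem dirTerm_mul_dirTerm (a b : ℚ) {M N : ℕ} (hM : M ≠ 0) :
    dirTerm a M * dirTerm b N = dirTerm (a * b) (M * N) := by
  ext j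
  rw [dirTerm_mul_apply a hM]
  simp only [dirTerm_apply]
  rcases eq_or_ne j 0 with rfl | hj
  · simp
  by_cases h : M ∣ j
  · obtain ⟨i, rfl⟩ := h
    have hi : i ≠ 0 := right_ne_zero_of_mul hj
    simp [hM, hi, Nat.mul_div_cancel_left i (Nat.pos_of_ne_zero hM)]
  · have : j ≠ M * N := by
      rintro rfl
      exact h (dvd_mul_right _ _)
    simp [h, this]

theorem dirTerm_one_one : dirTerm 1 1 = 1 := by
  ext j
  rw [dirTerm_apply, ArithmeticFunction.one_apply]
  split_ifs <;> first | rfl | omega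

theorem dirTerm_one_pow {N : ℕ} (hN : N ≠ 0) (r : ℕ) : dirTerm 1 N ^ r = dirTerm 1 (N ^ r) := by
  induction r with
  | zero => rw [pow_zero, pow_zero, dirTerm_one_one]
  | succ r ih => rw [pow_succ, ih, dirTerm_mul_dirTerm _ _ (pow_ne_zero r hN), pow_succ, one_mul]

/-- The substitution `s ↦ s - 1` on formal Dirichlet series: the `N`-th coefficient is
multiplied by `N`. -/
def dirichletShift : ArithmeticFunction ℚ →+* ArithmeticFunction ℚ where
  toFun f := ⟨fun N => N * f N, by simp⟩
  map_one' := by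
    ext N
    rcases eq_or_ne N 1 with rfl | h
    · simp
    · simp [ArithmeticFunction.one_apply_ne h]
  map_zero' := by ext N; simp
  map_add' f g := ArithmeticFunction.ext fun N => mul_add (N : ℚ) (f N) (g N)
  map_mul' f g := by
    ext N
    change (N : ℚ) * ∑ p ∈ N.divisorsAntidiagonal, f p.1 * g p.2 = _
    rw [Finset.mul_sum]
    refine Finset.sum_congr rfl fun p hp => ?_
    change (N : ℚ) * (f p.1 * g p.2) = p.1 * f p.1 * (p.2 * g p.2)
    rw [← (Nat.mem_divisorsAntidiagonal.1 hp).1]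
    push_cast
    ring

theorem dirichletShift_apply (f : ArithmeticFunction ℚ) (N : ℕ) :
    dirichletShift f N = N * f N := rfl

theorem dirichletShift_dirTerm (c : ℚ) (N : ℕ) :
    dirichletShift (dirTerm c N) = dirTerm (N * c) N := by
  ext j
  rw [dirichletShift_apply, dirTerm_apply, dirTerm_apply]
  split_ifs with h1 h2
  · simp
  · rw [h2]
  · simp

theorem map_qPoch {A B : Type*} [CommRing A] [CommRing B] (f : A →+* B) (a q : A) (n : ℕ) :
    f (qPoch a q n) = qPoch (f a) (f q) n := by
  simp [qPoch]

/-- With t = Q^(-s) this is (t; Q)_{n+1} = (1 - t)(Qt; Q)_n: the shift s ↦ s - 1 sends t to Qt and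
fixes the constant Q. -/
theorem qPoch_dirTerm_succ {Q : ℕ} (hQ : Q ≠ 0) (n : ℕ) :
    qPoch (dirTerm 1 Q) (dirTerm Q 1) (n + 1) =
      dirichletShift (qPoch (dirTerm 1 Q) (dirTerm Q 1) n) * (1 - dirTerm 1 Q) := by
  rw [qPoch_succ', map_qPoch, dirichletShift_dirTerm, dirichletShift_dirTerm,
    dirTerm_mul_dirTerm _ _ hQ]
  simp

end Dirichlet

/-! ### Counting along a fibration -/

section Fibration

variable {α β : Type*} (f : α → β) (ν μ : α → ℕ) (νβ : β → ℕ)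

/-- The elements of weight `N` of a fibred set, for a weight multiplicative along the fibration. -/
def fibrationEquiv (hν : ∀ a, ν a = νβ (f a) * μ a) {N : ℕ} (hN : N ≠ 0) :
    {a // ν a = N} ≃ Σ p : N.divisorsAntidiagonal, Σ b : {b // νβ b = p.1.1},
      {a // f a = b ∧ μ a = p.1.2} where
  toFun a := ⟨⟨(νβ (f a), μ a), Nat.mem_divisorsAntidiagonal.2
    ⟨(hν a.1).symm.trans a.2, hN⟩⟩, ⟨f a, rfl⟩, ⟨a, rfl, rfl⟩⟩
  invFun x := ⟨x.2.2.1, by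
    rw [hν, x.2.2.2.1, x.2.2.2.2, x.2.1.2]
    exact (Nat.mem_divisorsAntidiagonal.1 x.1.2).1⟩
  left_inv _ := rfl
  right_inv := by
    rintro ⟨⟨⟨m, c⟩, hp⟩, ⟨b, hb⟩, ⟨a, ha, hc⟩⟩
    have ha' : f a = b := ha
    subst ha'
    have hb' : νβ (f a) = m := hb
    subst hb'
    have hc' : μ a = c := hc
    subst hc'
    rfl

/-- The fibre count may depend on the base point through its weight, by the factor `h`. This is used
with `h = id` for kernels in O × N, and with `h = 1` for the O-span of an R-submodule. -/
theorem card_fibration (hν : ∀ a, ν a = νβ (f a) * μ a) {h s : ℕ → ℕ}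
    (hβ : ∀ m, m ≠ 0 → Finite {b // νβ b = m})
    (hfib : ∀ b c, νβ b ≠ 0 → c ≠ 0 → Finite {a // f a = b ∧ μ a = c} ∧
      Nat.card {a // f a = b ∧ μ a = c} = h (νβ b) * s c) {N : ℕ} (hN : N ≠ 0) :
    Finite {a // ν a = N} ∧ Nat.card {a // ν a = N} =
      ∑ p ∈ N.divisorsAntidiagonal, h p.1 * Nat.card {b // νβ b = p.1} * s p.2 := by
  have hp : ∀ p : N.divisorsAntidiagonal, p.1.1 ≠ 0 ∧ p.1.2 ≠ 0 := fun p => by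
    rw [← mul_ne_zero_iff, (Nat.mem_divisorsAntidiagonal.1 p.2).1]
    exact hN
  have hβ' (p : N.divisorsAntidiagonal) : Finite {b // νβ b = p.1.1} := hβ _ (hp p).1
  have hα (p : N.divisorsAntidiagonal) (b : {b // νβ b = p.1.1}) :
      Finite {a // f a = b ∧ μ a = p.1.2} :=
    (hfib b p.1.2 (b.2.symm ▸ (hp p).1) (hp p).2).1
  refine ⟨Finite.of_equiv _ (fibrationEquiv f ν μ νβ hν hN).symm, ?_⟩
  rw [Nat.card_congr (fibrationEquiv f ν μ νβ hν hN), Nat.card_sigma, 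
    ← Finset.sum_coe_sort N.divisorsAntidiagonal
      (fun p => h p.1 * Nat.card {b // νβ b = p.1} * s p.2)]
  refine Finset.sum_congr rfl fun p _ => ?_
  have := Fintype.ofFinite {b // νβ b = p.1.1}
  rw [Nat.card_sigma, Finset.sum_congr rfl fun b _ => by
    rw [(hfib b p.1.2 (b.2.symm ▸ (hp p).1) (hp p).2).2, b.2], Finset.sum_const, smul_eq_mul,
    Finset.card_univ, Nat.card_eq_fintype_card]
  ring

end Fibration

/-! ### Invariance of the Quot zeta function under isomorphism -/

section QuotZeta

theorem quotZeta_apply (R M : Type*) [CommRing R] [AddCommGroup M] [Module R M] {N : ℕ}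
    (hN : N ≠ 0) :
    quotZeta R M N = (Nat.card {L : Submodule R M // Nat.card (M ⧸ L) = N} : ℚ) :=
  if_neg hN

/-- A linear equivalence preserves the submodules of a given index. -/
def LinearEquiv.submoduleIndexEquiv {R M M' : Type*} [CommRing R] [AddCommGroup M] [Module R M]
    [AddCommGroup M'] [Module R M'] (e : M ≃ₗ[R] M') (N : ℕ) :
    {L : Submodule R M // Nat.card (M ⧸ L) = N} ≃ {L : Submodule R M' // Nat.card (M' ⧸ L) = N} :=
  (Submodule.orderIsoMapComap e).toEquiv.subtypeEquiv fun L => by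
    rw [Nat.card_congr (Submodule.Quotient.equiv L _ e rfl).toEquiv]
    rfl

theorem LinearEquiv.quotZeta_eq {R M M' : Type*} [CommRing R] [AddCommGroup M] [Module R M]
    [AddCommGroup M'] [Module R M'] (e : M ≃ₗ[R] M') : quotZeta R M = quotZeta R M' := by
  ext N
  rcases eq_or_ne N 0 with rfl | hN
  · simp
  · rw [quotZeta_apply R M hN, quotZeta_apply R M' hN, Nat.card_congr (e.submoduleIndexEquiv N)]

theorem LinearEquiv.quotZetaWellDefined {R M M' : Type*} [CommRing R] [AddCommGroup M]
    [Module R M] [AddCommGroup M'] [Module R M'] (e : M ≃ₗ[R] M')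
    (h : QuotZetaWellDefined R M') : QuotZetaWellDefined R M := fun N hN => by
  have : Finite {L : Submodule R M' // Nat.card (M' ⧸ L) = N} := (h N hN).to_subtype
  exact @Set.toFinite _ _ (Finite.of_equiv _ (e.submoduleIndexEquiv N).symm)

end QuotZeta

/-! ### Submodules of O × N over a principal ideal domain -/

section PrincipalIdealProduct

/-- The elements with a property of `g a`, fibred over the values of `g`. -/
def subtypeAndEquivSigma {α γ : Type*} (P : α → Prop) (Q : γ → Prop) (g : α → γ) :
    {a // P a ∧ Q (g a)} ≃ Σ c : {c // Q c}, {a // P a ∧ g a = c} where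
  toFun a := ⟨⟨g a, a.2.2⟩, ⟨a, a.2.1, rfl⟩⟩
  invFun x := ⟨x.2.1, x.2.2.1, x.2.2.2.symm ▸ x.1.2⟩
  left_inv _ := rfl
  right_inv := by
    rintro ⟨⟨c, hc⟩, ⟨a, ha, hac⟩⟩
    have hac' : g a = c := hac
    subst hac'
    rfl

variable {O N : Type*} [CommRing O] [AddCommGroup N] [Module O N]

/-- In the chain M ⊆ M + (0 × N) ⊆ O × N, the lower quotient is N modulo the kernel and the upper
one is O modulo the image. Indices are multiplicative even when infinite (recorded as 0), so no
finiteness is needed. -/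
theorem card_quotient_prod (M : Submodule O (O × N)) :
    Nat.card ((O × N) ⧸ M) = Nat.card (N ⧸ M.comap (LinearMap.inr O O N)) *
      Nat.card (O ⧸ M.map (LinearMap.fst O O N)) := by
  simp only [← Submodule.cardQuot_apply, Submodule.cardQuot]
  have h1 : (M.map (LinearMap.fst O O N)).toAddSubgroup =
      M.toAddSubgroup.map (AddMonoidHom.fst O N) := rfl
  have h2 : (M.comap (LinearMap.inr O O N)).toAddSubgroup =
      M.toAddSubgroup.comap (AddMonoidHom.inr O N) := rfl
  have h3 : (AddMonoidHom.fst O N).ker = (AddMonoidHom.inr O N).range := by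
    ext ⟨x, y⟩
    constructor
    · exact fun h => ⟨y, Prod.ext (Eq.symm h) rfl⟩
    · rintro ⟨z, hz⟩
      rw [← hz]
      rfl
  rw [h1, h2, AddSubgroup.index_comap, AddSubgroup.index_map, h3,
    AddMonoidHom.range_eq_top_of_surjective (AddMonoidHom.fst O N) Prod.fst_surjective, AddSubgroup.index_top, mul_one,
    ← AddSubgroup.relIndex_sup_left, AddSubgroup.relIndex_mul_index le_sup_left]

/-- The submodule of `O × N` generated by `(g, v)` and `0 × M'`, where `v` lifts `w`. -/
def liftSubmodule (M' : Submodule O N) (g : O) (w : N ⧸ M') : Submodule O (O × N) where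
  carrier := {p | ∃ c : O, p.1 = c * g ∧ M'.mkQ p.2 = c • w}
  add_mem' := by
    rintro p p' ⟨c, h, h'⟩ ⟨d, e, e'⟩
    exact ⟨c + d, by rw [Prod.fst_add, h, e, add_mul], by
      rw [Prod.snd_add, map_add, h', e', add_smul]⟩
  zero_mem' := ⟨0, by simp, by simp⟩
  smul_mem' := by
    rintro a p ⟨c, h, h'⟩
    exact ⟨a * c, by rw [Prod.smul_fst, h, smul_eq_mul, mul_assoc], by
      rw [Prod.smul_snd, map_smul, h', mul_smul]⟩

theorem mem_liftSubmodule {M' : Submodule O N} {g : O} {w : N ⧸ M'} {p : O × N} :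
    p ∈ liftSubmodule M' g w ↔ ∃ c : O, p.1 = c * g ∧ M'.mkQ p.2 = c • w := Iff.rfl

theorem comap_inr_liftSubmodule [IsDomain O] (M' : Submodule O N) {g : O} (hg : g ≠ 0) (w : N ⧸ M') :
    (liftSubmodule M' g w).comap (LinearMap.inr O O N) = M' := by
  ext y
  simp only [Submodule.mem_comap, mem_liftSubmodule, LinearMap.inr_apply]
  constructor
  · rintro ⟨c, h, h'⟩
    obtain rfl : c = 0 := (mul_eq_zero.1 h.symm).resolve_right hg
    rw [zero_smul] at h'
    exact (Submodule.Quotient.mk_eq_zero M').1 h'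
  · intro hy
    exact ⟨0, by simp, by rw [zero_smul]; exact (Submodule.Quotient.mk_eq_zero M').2 hy⟩

theorem map_fst_liftSubmodule (M' : Submodule O N) (g : O) (w : N ⧸ M') :
    (liftSubmodule M' g w).map (LinearMap.fst O O N) = Ideal.span {g} := by
  ext x
  simp only [Submodule.mem_map, mem_liftSubmodule, LinearMap.fst_apply]
  constructor
  · rintro ⟨p, ⟨c, h, -⟩, rfl⟩
    exact Ideal.mem_span_singleton'.2 ⟨c, h.symm⟩
  · intro hx
    obtain ⟨c, rfl⟩ := Ideal.mem_span_singleton'.1 hx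
    obtain ⟨v, rfl⟩ := M'.mkQ_surjective w
    exact ⟨(c * g, c • v), ⟨c, rfl, map_smul _ _ _⟩, rfl⟩

theorem liftSubmodule_injective [IsDomain O] (M' : Submodule O N) {g : O} (hg : g ≠ 0) :
    Function.Injective (liftSubmodule M' g) := fun w w' h => by
  obtain ⟨v, rfl⟩ := M'.mkQ_surjective w
  have : (g, v) ∈ liftSubmodule M' g w' := h ▸ ⟨1, by simp, by simp⟩
  obtain ⟨c, h1, h2⟩ := this
  obtain rfl : c = 1 := (mul_right_cancel₀ hg (by rw [one_mul]; exact h1)).symm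
  rw [one_smul] at h2
  exact h2

/-- Any v with (g, v) in M will do: its class modulo the kernel of the first projection on M is the
required w. -/
theorem exists_eq_liftSubmodule (M : Submodule O (O × N)) {g : O}
    (hM : M.map (LinearMap.fst O O N) = Ideal.span {g}) :
    ∃ w, liftSubmodule (M.comap (LinearMap.inr O O N)) g w = M := by
  obtain ⟨⟨x, v⟩, hv, rfl⟩ : g ∈ M.map (LinearMap.fst O O N) :=
    hM ▸ Ideal.mem_span_singleton_self g
  rw [LinearMap.fst_apply] at hM ⊢
  refine ⟨Submodule.mkQ _ v, ?_⟩
  have key : ∀ (c : O) (y : N), (c * x, y) ∈ M ↔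
      y - c • v ∈ M.comap (LinearMap.inr O O N) := fun c y => by
    have e : (c * x, y) = (0, y - c • v) + c • (x, v) := by simp
    rw [e, M.add_mem_iff_left (M.smul_mem c hv)]
    rfl
  ext ⟨z, y⟩
  rw [mem_liftSubmodule]
  constructor
  · rintro ⟨c, h, h'⟩
    dsimp only at h h'
    subst h
    rw [key]
    rw [← map_smul] at h'
    exact (Submodule.Quotient.eq _).1 h'
  · intro h
    have : z ∈ Ideal.span {x} := hM ▸ ⟨_, h, rfl⟩
    obtain ⟨c, rfl⟩ := Ideal.mem_span_singleton'.1 this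
    refine ⟨c, rfl, ?_⟩
    rw [← map_smul]
    exact (Submodule.Quotient.eq _).2 ((key c y).1 h)

/-- The submodules of `O × N` with given kernel and given nonzero principal image. -/
noncomputable def fiberEquivQuotient [IsDomain O] (M' : Submodule O N) {g : O} (hg : g ≠ 0) :
    (N ⧸ M') ≃ {M : Submodule O (O × N) // M.comap (LinearMap.inr O O N) = M' ∧
      M.map (LinearMap.fst O O N) = Ideal.span {g}} :=
  Equiv.ofBijective (fun w => ⟨liftSubmodule M' g w, comap_inr_liftSubmodule M' hg w,
    map_fst_liftSubmodule M' g w⟩) ⟨fun _ _ h => liftSubmodule_injective M' hg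
      (congrArg Subtype.val h), by
      rintro ⟨M, rfl, h⟩
      obtain ⟨w, hw⟩ := exists_eq_liftSubmodule M h
      exact ⟨w, Subtype.ext hw⟩⟩

theorem ne_bot_of_card_quotient_ne_zero [Infinite O] {I : Ideal O} (h : Nat.card (O ⧸ I) ≠ 0) : I ≠ ⊥ := by
  rintro rfl
  have := Nat.finite_of_card_ne_zero h
  have := Finite.of_equiv _ (Submodule.quotEquivOfEqBot (⊥ : Ideal O) rfl).toEquiv
  exact not_finite O

variable [IsDomain O] [IsPrincipalIdealRing O] [Infinite O]

/-- The submodules of `O × N` with given kernel and given image index. -/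
noncomputable def fiberEquivProd (M' : Submodule O N) {c : ℕ} (hc : c ≠ 0) :
    {M : Submodule O (O × N) // M.comap (LinearMap.inr O O N) = M' ∧
      Nat.card (O ⧸ M.map (LinearMap.fst O O N)) = c} ≃
      {I : Ideal O // Nat.card (O ⧸ I) = c} × (N ⧸ M') :=
  calc
    _ ≃ Σ I : {I : Ideal O // Nat.card (O ⧸ I) = c},
        {M : Submodule O (O × N) // M.comap (LinearMap.inr O O N) = M' ∧
          M.map (LinearMap.fst O O N) = I} :=
      subtypeAndEquivSigma _ _ _
    _ ≃ Σ _ : {I : Ideal O // Nat.card (O ⧸ I) = c}, (N ⧸ M') :=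
      Equiv.sigmaCongrRight fun I => by
        have hI : Submodule.IsPrincipal.generator I.1 ≠ 0 := fun h =>
          ne_bot_of_card_quotient_ne_zero (I.2.symm ▸ hc)
            ((Submodule.IsPrincipal.eq_bot_iff_generator_eq_zero _).2 h)
        exact (Equiv.subtypeEquivRight fun M => by
          rw [Ideal.span_singleton_generator]).trans (fiberEquivQuotient M' hI).symm
    _ ≃ _ := Equiv.sigmaEquivProd _ _

/-- Fibre over the kernel M' ⊆ N. Each image ideal contributes |N/M'| submodules, and weighting M'
by its index is the shift s ↦ s - 1. -/
theorem quotZeta_prod (hO : QuotZetaWellDefined O O) (hN : QuotZetaWellDefined O N) :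
    QuotZetaWellDefined O (O × N) ∧
      quotZeta O (O × N) = dirichletShift (quotZeta O N) * quotZeta O O := by
  have key := fun (m : ℕ) (hm : m ≠ 0) => card_fibration
    (fun M : Submodule O (O × N) => M.comap (LinearMap.inr O O N))
    (fun M => Nat.card ((O × N) ⧸ M)) (fun M => Nat.card (O ⧸ M.map (LinearMap.fst O O N)))
    (fun M' => Nat.card (N ⧸ M')) card_quotient_prod (h := id)
    (s := fun c => Nat.card {I : Ideal O // Nat.card (O ⧸ I) = c})
    (fun m hm => (hN m hm).to_subtype) (fun M' c hM' hc => by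
      have := Nat.finite_of_card_ne_zero hM'
      have : Finite {I : Ideal O // Nat.card (O ⧸ I) = c} := (hO c hc).to_subtype
      refine ⟨Finite.of_equiv _ (fiberEquivProd M' hc).symm, ?_⟩
      rw [Nat.card_congr (fiberEquivProd M' hc), Nat.card_prod, mul_comm, id]) hm
  refine ⟨fun m hm => @Set.toFinite _ _ (key m hm).1, ?_⟩
  ext m
  rcases eq_or_ne m 0 with rfl | hm
  · simp
  rw [quotZeta_apply _ _ hm, (key m hm).2, ArithmeticFunction.mul_apply, Nat.cast_sum]
  refine Finset.sum_congr rfl fun p hp => ?_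
  have hp' : p.1 * p.2 ≠ 0 := by
    rw [(Nat.mem_divisorsAntidiagonal.1 hp).1]
    exact hm
  rw [dirichletShift_apply, quotZeta_apply _ _ (left_ne_zero_of_mul hp'),
    quotZeta_apply _ _ (right_ne_zero_of_mul hp')]
  push_cast
  rfl

end PrincipalIdealProduct

/-! ### The zeta function of the free module over power series -/

section PowerSeriesZeta

variable (l : Type*) [Field l]

instance PowerSeries.infinite : Infinite l⟦X⟧ :=
  Infinite.of_injective (fun a : ℕ => (PowerSeries.X : l⟦X⟧) ^ a) fun a b h => by
    have := congrArg PowerSeries.order h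
    simpa [PowerSeries.order_X_pow] using this

theorem card_quotient_span_X_pow (a : ℕ) :
    Nat.card (l⟦X⟧ ⧸ Ideal.span {(PowerSeries.X : l⟦X⟧) ^ a}) = Nat.card l ^ a := by
  have := PowerSeries.span_X_isPrime (R := l)
  have hker : (PowerSeries.constantCoeff (R := l)).toAddMonoidHom.ker =
      (Ideal.span {(PowerSeries.X : l⟦X⟧)}).toAddSubgroup := by
    ext f
    exact (PowerSeries.X_dvd_iff (φ := f)).symm.trans Ideal.mem_span_singleton.symm
  rw [← Ideal.span_singleton_pow, ← Submodule.cardQuot_apply, cardQuot_pow_of_prime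
    (by rw [Ne, Ideal.span_singleton_eq_bot]; exact PowerSeries.X_ne_zero), Submodule.cardQuot]
  congr 1
  rw [← hker, AddSubgroup.index_ker, AddMonoidHom.range_eq_top_of_surjective _
    PowerSeries.constantCoeff_surj, AddSubgroup.card_top]

variable {l}

theorem exists_eq_span_X_pow {I : Ideal l⟦X⟧} (hI : Nat.card (l⟦X⟧ ⧸ I) ≠ 0) :
    ∃ a : ℕ, I = Ideal.span {(PowerSeries.X : l⟦X⟧) ^ a} :=
  IsDiscreteValuationRing.ideal_eq_span_pow_irreducible (ne_bot_of_card_quotient_ne_zero hI)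
    PowerSeries.X_prime.irreducible

variable [Finite l]

theorem subsingleton_ideal_card_eq {N : ℕ} (hN : N ≠ 0) :
    Subsingleton {I : Ideal l⟦X⟧ // Nat.card (l⟦X⟧ ⧸ I) = N} := by
  refine ⟨fun ⟨I, hI⟩ ⟨J, hJ⟩ => Subtype.ext ?_⟩
  obtain ⟨a, rfl⟩ := exists_eq_span_X_pow (hI.symm ▸ hN)
  obtain ⟨b, rfl⟩ := exists_eq_span_X_pow (hJ.symm ▸ hN)
  rw [card_quotient_span_X_pow] at hI hJ
  dsimp only
  rw [Nat.pow_right_injective (Finite.one_lt_card (α := l)) (hI.trans hJ.symm)]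

theorem quotZetaWellDefined_powerSeries : QuotZetaWellDefined l⟦X⟧ l⟦X⟧ := fun N hN => by
  have : Subsingleton {I : Ideal l⟦X⟧ // Nat.card (l⟦X⟧ ⧸ I) = N} := subsingleton_ideal_card_eq hN
  exact @Set.toFinite _ _ (@Finite.of_subsingleton _ this)

open scoped Classical in
theorem quotZeta_powerSeries_apply {N : ℕ} (hN : N ≠ 0) :
    quotZeta l⟦X⟧ l⟦X⟧ N = if ∃ a, N = Nat.card l ^ a then 1 else 0 := by
  rw [quotZeta_apply _ _ hN]
  have := subsingleton_ideal_card_eq (l := l) hN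
  split_ifs with h
  · obtain ⟨a, rfl⟩ := h
    have : Nonempty {I : Ideal l⟦X⟧ // Nat.card (l⟦X⟧ ⧸ I) = Nat.card l ^ a} :=
      ⟨⟨_, card_quotient_span_X_pow l a⟩⟩
    exact_mod_cast Nat.card_unique
  · have : IsEmpty {I : Ideal l⟦X⟧ // Nat.card (l⟦X⟧ ⧸ I) = N} := ⟨fun ⟨I, hI⟩ => h (by
      obtain ⟨a, rfl⟩ := exists_eq_span_X_pow (hI.symm ▸ hN)
      exact ⟨a, by rw [← hI, card_quotient_span_X_pow]⟩)⟩
    exact_mod_cast Nat.card_of_isEmpty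

/-- The finite-index ideals are the (X^a), one of each index Q^a, so the zeta function is a
geometric series in Q^(-s). -/
theorem one_sub_mul_quotZeta_powerSeries :
    (1 - dirTerm 1 (Nat.card l)) * quotZeta l⟦X⟧ l⟦X⟧ = 1 := by
  classical
  have hQ1 : 1 < Nat.card l := Finite.one_lt_card
  rw [sub_mul, one_mul, sub_eq_iff_eq_add]
  ext N
  rcases eq_or_ne N 0 with rfl | hN
  · simp
  rw [ArithmeticFunction.add_apply, dirTerm_mul_apply _ (by omega), quotZeta_powerSeries_apply hN,
    ArithmeticFunction.one_apply, one_mul]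
  by_cases hdvd : Nat.card l ∣ N
  · obtain ⟨m, rfl⟩ := hdvd
    have hm : m ≠ 0 := right_ne_zero_of_mul hN
    have h1 : Nat.card l * m ≠ 1 := fun h => hQ1.ne' (Nat.dvd_one.1 ⟨m, h.symm⟩)
    rw [if_neg h1, if_pos (dvd_mul_right _ _), Nat.mul_div_cancel_left m (by omega),
      quotZeta_powerSeries_apply hm, zero_add]
    congr 1
    refine propext ⟨?_, ?_⟩
    · rintro ⟨a, ha⟩
      cases a with
      | zero => exact absurd ha h1
      | succ a => exact ⟨a, Nat.eq_of_mul_eq_mul_left (by omega : 0 < Nat.card l) (by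
          rw [ha, pow_succ'])⟩
    · rintro ⟨a, rfl⟩
      exact ⟨a + 1, (pow_succ' _ _).symm⟩
  · rw [if_neg hdvd, add_zero]
    congr 1
    refine propext ⟨?_, ?_⟩
    · rintro ⟨a, rfl⟩
      cases a with
      | zero => rfl
      | succ a => exact absurd (dvd_pow_self _ a.succ_ne_zero) hdvd
    · rintro rfl
      exact ⟨0, rfl⟩

/-- The zeta function of the lattice `l⟦X⟧^n`. -/
theorem qPoch_mul_quotZeta_powerSeries_pi (n : ℕ) :
    QuotZetaWellDefined l⟦X⟧ (Fin n → l⟦X⟧) ∧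
      qPoch (dirTerm 1 (Nat.card l)) (dirTerm (Nat.card l) 1) n *
        quotZeta l⟦X⟧ (Fin n → l⟦X⟧) = 1 := by
  induction n with
  | zero =>
    refine ⟨fun N _ => Set.toFinite _, ?_⟩
    ext N
    rcases eq_or_ne N 0 with rfl | hN
    · simp
    have hcard (L : Submodule l⟦X⟧ (Fin 0 → l⟦X⟧)) : Nat.card ((Fin 0 → l⟦X⟧) ⧸ L) = 1 := by
      have : Subsingleton ((Fin 0 → l⟦X⟧) ⧸ L) := L.mkQ_surjective.subsingleton
      exact Nat.card_unique
    rw [qPoch, Finset.prod_range_zero, one_mul, quotZeta_apply _ _ hN,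
      ArithmeticFunction.one_apply]
    simp only [hcard]
    split_ifs with h
    · subst h
      simp
    · simp [Ne.symm h]
  | succ n ih =>
    have e := (Fin.consLinearEquiv l⟦X⟧ (fun _ : Fin n.succ => l⟦X⟧)).symm
    obtain ⟨h1, h2⟩ := quotZeta_prod (quotZetaWellDefined_powerSeries (l := l)) ih.1
    refine ⟨e.quotZetaWellDefined h1, ?_⟩
    -- The shift is a ring homomorphism, so it may be applied to the whole inductive identity.
    rw [e.quotZeta_eq, h2, qPoch_dirTerm_succ Nat.card_pos.ne', mul_mul_mul_comm, ← map_mul, ih.2,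
      map_one, one_mul, one_sub_mul_quotZeta_powerSeries]

end PowerSeriesZeta

/-! ### Reduction modulo X of modules over the inert order -/

section InertOrder

variable {k l : Type*} [Field k] [Field l] [Algebra k l]

/-- For m = 1 the order is the preimage of k under reduction modulo X. In particular it contains the
ideal X·l⟦X⟧. -/
theorem mem_inertOrder_one {f : l⟦X⟧} :
    f ∈ inertOrder k l 1 ↔ ∃ a : k, PowerSeries.constantCoeff f = algebraMap k l a := by
  constructor
  · rintro ⟨a, b, rfl⟩
    exact ⟨PowerSeries.constantCoeff a, by
      rw [map_add, map_mul, map_pow, PowerSeries.constantCoeff_X, pow_one, zero_mul, add_zero]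
      simpa only [PowerSeries.coeff_zero_eq_constantCoeff_apply] using
        PowerSeries.coeff_map (algebraMap k l) 0 a⟩
  · rintro ⟨a, ha⟩
    obtain ⟨g, hg⟩ : (PowerSeries.X : l⟦X⟧) ∣ f - PowerSeries.C (algebraMap k l a) := by
      rw [PowerSeries.X_dvd_iff]
      simp [ha]
    exact ⟨PowerSeries.C a, g, by rw [pow_one, ← hg]; simp⟩

theorem X_mul_mem_inertOrder (f : l⟦X⟧) : PowerSeries.X * f ∈ inertOrder k l 1 :=
  mem_inertOrder_one.2 ⟨0, by simp⟩

theorem C_algebraMap_mem_inertOrder (a : k) :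
    PowerSeries.C (algebraMap k l a) ∈ inertOrder k l 1 :=
  mem_inertOrder_one.2 ⟨a, by simp⟩

instance PowerSeries.constantCoeff_ringHomSurjective :
    RingHomSurjective (PowerSeries.constantCoeff (R := l)) :=
  ⟨PowerSeries.constantCoeff_surj⟩

variable (l) in
/-- The reduction `l⟦X⟧^n → l^n` modulo `X`. -/
noncomputable def reductionModX (n : ℕ) :
    (Fin n → l⟦X⟧) →ₛₗ[PowerSeries.constantCoeff (R := l)] (Fin n → l) where
  toFun x i := PowerSeries.constantCoeff (x i)
  map_add' x y := by ext i; simp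
  map_smul' c x := by ext i; simp

theorem reductionModX_surjective (n : ℕ) : Function.Surjective (reductionModX l n) := fun y =>
  ⟨fun i => PowerSeries.C (y i), by ext i; simp [reductionModX]⟩

theorem exists_eq_X_smul {n : ℕ} {x : Fin n → l⟦X⟧} (hx : reductionModX l n x = 0) :
    ∃ y : Fin n → l⟦X⟧, x = (PowerSeries.X : l⟦X⟧) • y := by
  choose y hy using fun i => PowerSeries.X_dvd_iff.2 (congrFun hx i)
  exact ⟨y, funext hy⟩

/-- Since X·l⟦X⟧ lies in the order, L absorbs X·l⟦X⟧·L, which is X·l⟦X⟧^n when L generates. -/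
theorem mem_of_reductionModX_eq_zero {n : ℕ} {L : Submodule (inertOrder k l 1) (Fin n → l⟦X⟧)}
    (hL : Submodule.span l⟦X⟧ (L : Set (Fin n → l⟦X⟧)) = ⊤) {x : Fin n → l⟦X⟧}
    (hx : reductionModX l n x = 0) : x ∈ L := by
  obtain ⟨y, rfl⟩ := exists_eq_X_smul hx
  -- The extra scalar `a` lets the induction pass through multiplication by elements of l⟦X⟧.
  have key : ∀ y ∈ Submodule.span l⟦X⟧ (L : Set (Fin n → l⟦X⟧)), ∀ a : l⟦X⟧,
      (PowerSeries.X * a) • y ∈ L := fun y hy => by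
    induction hy using Submodule.span_induction with
    | mem y hy => exact fun a => L.smul_mem ⟨_, X_mul_mem_inertOrder a⟩ hy
    | zero => exact fun a => by rw [smul_zero]; exact L.zero_mem
    | add y z _ _ h h' => exact fun a => by rw [smul_add]; exact L.add_mem (h a) (h' a)
    | smul b y _ h => exact fun a => by rw [smul_smul, mul_assoc]; exact h (a * b)
  simpa using key y (hL ▸ trivial) 1

/-- The image in `l^n` of a module over the inert order. -/
noncomputable def reductionImage {n : ℕ} (L : Submodule (inertOrder k l 1) (Fin n → l⟦X⟧)) :
    Submodule k (Fin n → l) where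
  carrier := reductionModX l n '' L
  add_mem' := by
    rintro _ _ ⟨x, hx, rfl⟩ ⟨y, hy, rfl⟩
    exact ⟨x + y, L.add_mem hx hy, map_add _ _ _⟩
  zero_mem' := ⟨0, L.zero_mem, map_zero _⟩
  smul_mem' := by
    rintro a _ ⟨x, hx, rfl⟩
    refine ⟨PowerSeries.C (algebraMap k l a) • x,
      L.smul_mem ⟨_, C_algebraMap_mem_inertOrder a⟩ hx, ?_⟩
    rw [map_smulₛₗ, PowerSeries.constantCoeff_C, algebraMap_smul]

/-- The preimage in `l⟦X⟧^n` of a `k`-subspace of `l^n`. -/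
noncomputable def reductionPreimage {n : ℕ} (W : Submodule k (Fin n → l)) :
    Submodule (inertOrder k l 1) (Fin n → l⟦X⟧) where
  carrier := reductionModX l n ⁻¹' W
  add_mem' {x y} hx hy := by
    rw [Set.mem_preimage, map_add]
    exact W.add_mem hx hy
  zero_mem' := by
    rw [Set.mem_preimage, map_zero]
    exact W.zero_mem
  smul_mem' := by
    rintro ⟨f, hf⟩ x hx
    obtain ⟨a, ha⟩ := mem_inertOrder_one.1 hf
    change reductionModX l n (f • x) ∈ W
    rw [map_smulₛₗ, ha, algebraMap_smul]
    exact W.smul_mem a hx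

theorem reductionImage_reductionPreimage {n : ℕ} (W : Submodule k (Fin n → l)) :
    reductionImage (reductionPreimage W) = W :=
  SetLike.coe_injective (Set.image_preimage_eq _ (reductionModX_surjective n))

theorem reductionPreimage_reductionImage {n : ℕ}
    {L : Submodule (inertOrder k l 1) (Fin n → l⟦X⟧)}
    (hL : Submodule.span l⟦X⟧ (L : Set (Fin n → l⟦X⟧)) = ⊤) :
    reductionPreimage (reductionImage L) = L := by
  refine le_antisymm ?_ (Set.subset_preimage_image _ _)
  rintro x ⟨y, hy, hxy⟩
  have : x - y ∈ L := mem_of_reductionModX_eq_zero hL (by rw [map_sub, hxy, sub_self])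
  simpa using L.add_mem this hy

theorem card_quotient_reductionPreimage {n : ℕ} (W : Submodule k (Fin n → l)) :
    Nat.card ((Fin n → l⟦X⟧) ⧸ reductionPreimage W) = Nat.card ((Fin n → l) ⧸ W) :=
  AddSubgroup.index_comap_of_surjective W.toAddSubgroup
    (f := (reductionModX l n).toAddMonoidHom) (reductionModX_surjective n)

/-- Nakayama's lemma over the local ring l⟦X⟧, whose maximal ideal is (X). -/
theorem span_reductionImage_eq_top_iff {n : ℕ}
    (L : Submodule (inertOrder k l 1) (Fin n → l⟦X⟧)) :
    Submodule.span l (reductionImage L : Set (Fin n → l)) = ⊤ ↔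
      Submodule.span l⟦X⟧ (L : Set (Fin n → l⟦X⟧)) = ⊤ := by
  have hmap : (Submodule.span l⟦X⟧ (L : Set (Fin n → l⟦X⟧))).map (reductionModX l n) =
      Submodule.span l (reductionImage L : Set (Fin n → l)) := Submodule.map_span _ _
  rw [← hmap]
  constructor
  · intro h
    refine top_le_iff.1 (Submodule.le_of_le_smul_of_le_jacobson_bot
      (I := Ideal.span {(PowerSeries.X : l⟦X⟧)}) Module.Finite.fg_top ?_ ?_)
    · rw [IsLocalRing.jacobson_eq_maximalIdeal ⊥ bot_ne_top, PowerSeries.maximalIdeal_eq_span_X]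
    · intro x _
      obtain ⟨y, hy, hxy⟩ : reductionModX l n x ∈
          (Submodule.span l⟦X⟧ (L : Set (Fin n → l⟦X⟧))).map (reductionModX l n) := h ▸ trivial
      obtain ⟨z, hz⟩ := exists_eq_X_smul (x := x - y) (by rw [map_sub, hxy, sub_self])
      rw [← add_sub_cancel y x, hz]
      exact Submodule.add_mem_sup hy (Submodule.smul_mem_smul
        (Ideal.mem_span_singleton_self _) trivial)
  · intro h
    rw [h, Submodule.map_top, LinearMap.range_eq_top]
    exact reductionModX_surjective n

/-- The submodules over the inert order that generate `l⟦X⟧^n` are the preimages of the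
`k`-subspaces that generate `l^n`. -/
noncomputable def spanTopEquiv (k l : Type*) [Field k] [Field l] [Algebra k l] (n c : ℕ) :
    {L : Submodule (inertOrder k l 1) (Fin n → l⟦X⟧) //
      Submodule.span l⟦X⟧ (L : Set (Fin n → l⟦X⟧)) = ⊤ ∧ Nat.card ((Fin n → l⟦X⟧) ⧸ L) = c} ≃
    {W : Submodule k (Fin n → l) //
      Submodule.span l (W : Set (Fin n → l)) = ⊤ ∧ Nat.card ((Fin n → l) ⧸ W) = c} where
  toFun L := ⟨reductionImage L.1, (span_reductionImage_eq_top_iff L.1).2 L.2.1, by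
    rw [← card_quotient_reductionPreimage, reductionPreimage_reductionImage L.2.1, L.2.2]⟩
  invFun W := ⟨reductionPreimage W.1, by
    rw [← span_reductionImage_eq_top_iff, reductionImage_reductionPreimage]
    exact W.2.1, (card_quotient_reductionPreimage W.1).trans W.2.2⟩
  left_inv L := Subtype.ext (reductionPreimage_reductionImage L.2.1)
  right_inv W := Subtype.ext (reductionImage_reductionPreimage W.1)

end InertOrder

/-! ### Transport of the fibres to the full lattice -/

section Lattice

variable {O E : Type*} [CommRing O] [AddCommGroup E] [Module O E]

/-- O is infinite and the quotient finite, so two distinct scalars act on it alike. Their difference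
d ≠ 0 satisfies d·O^n ⊆ M, so M has rank n, and it is free over a principal ideal domain. -/
theorem exists_linearMap_range_eq [IsDomain O] [IsPrincipalIdealRing O] [Infinite O] (n : ℕ)
    (M : Submodule O (Fin n → O)) (hM : Nat.card ((Fin n → O) ⧸ M) ≠ 0) :
    ∃ j : (Fin n → O) →ₗ[O] (Fin n → O), Function.Injective j ∧ LinearMap.range j = M := by
  have := Nat.finite_of_card_ne_zero hM
  obtain ⟨a, b, hab, h⟩ := Finite.exists_ne_map_eq_of_infinite
    (fun a : O => (fun x : (Fin n → O) ⧸ M => a • x))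
  have hmem : ∀ x : Fin n → O, (a - b) • x ∈ M := fun x => by
    rw [← Submodule.Quotient.mk_eq_zero, Submodule.Quotient.mk_smul, sub_smul, sub_eq_zero]
    exact congrFun h (M.mkQ x)
  have hrank : Module.finrank O M = n := by
    refine le_antisymm ((Submodule.finrank_le M).trans (Module.finrank_fin_fun O).le) ?_
    refine (Module.finrank_fin_fun O).ge.trans (LinearMap.finrank_le_finrank_of_injective
      (f := (LinearMap.lsmul O (Fin n → O) (a - b)).codRestrict M hmem) fun x y hxy => ?_)
    exact smul_right_injective _ (sub_ne_zero.2 hab) (congrArg Subtype.val hxy)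
  have e : (Fin n → O) ≃ₗ[O] M := LinearEquiv.ofFinrankEq _ _ (by simp [hrank])
  refine ⟨M.subtype ∘ₗ e.toLinearMap, M.subtype_injective.comp e.injective, ?_⟩
  rw [LinearMap.range_comp, LinearEquiv.range, Submodule.map_top, Submodule.range_subtype]

variable {E' : Type*} [AddCommGroup E'] [Module O E'] (R : Subring O)

/-- An injective map identifies the `R`-submodules generating the source over `O` with those
generating the range over `O`. -/
def spanEqRangeEquiv (j : E' →ₗ[O] E) (hj : Function.Injective j) (c : ℕ) :
    {L : Submodule R E // Submodule.span O (L : Set E) = LinearMap.range j ∧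
      L.toAddSubgroup.relIndex (Submodule.span O (L : Set E)).toAddSubgroup = c} ≃
    {L : Submodule R E' // Submodule.span O (L : Set E') = ⊤ ∧ Nat.card (E' ⧸ L) = c} :=
  have hspan : ∀ L : Submodule R E', Submodule.span O (L.map (j.restrictScalars R) : Set E) =
      (Submodule.span O (L : Set E')).map j := fun L => (Submodule.map_span j _).symm
  have hcard : ∀ L : Submodule R E', (L.map (j.restrictScalars R)).toAddSubgroup.relIndex
      (LinearMap.range j).toAddSubgroup = Nat.card (E' ⧸ L) := fun L => by
    have h1 : (LinearMap.range j).toAddSubgroup = (⊤ : AddSubgroup E').map j.toAddMonoidHom :=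
      AddSubgroup.ext fun x => by simp
    rw [h1]
    exact (AddSubgroup.relIndex_map_map_of_injective L.toAddSubgroup ⊤ hj).trans
      (AddSubgroup.relIndex_top_right _)
  have hmap : ∀ L : Submodule R E, Submodule.span O (L : Set E) = LinearMap.range j →
      (L.comap (j.restrictScalars R)).map (j.restrictScalars R) = L := fun L hL =>
    Submodule.map_comap_eq_of_le fun x hx => by
      have : x ∈ LinearMap.range j := hL ▸ Submodule.subset_span hx
      exact this
  { toFun := fun L => ⟨L.1.comap (j.restrictScalars R), by
        apply Submodule.map_injective_of_injective hj
        rw [← hspan, hmap _ L.2.1, L.2.1, Submodule.map_top], by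
        have := L.2.2
        rw [L.2.1] at this
        rw [← hcard, hmap _ L.2.1, this]⟩
    invFun := fun L => ⟨L.1.map (j.restrictScalars R), by
        rw [hspan, L.2.1, Submodule.map_top], by
        rw [hspan, L.2.1, Submodule.map_top, hcard, L.2.2]⟩
    left_inv := fun L => Subtype.ext (hmap L.1 L.2.1)
    right_inv := fun L => Subtype.ext (Submodule.comap_map_eq_of_injective (f := j.restrictScalars R) hj L.1) }

theorem card_quotient_eq_mul_relIndex (L : Submodule R E) :
    Nat.card (E ⧸ L) = Nat.card (E ⧸ Submodule.span O (L : Set E)) *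
      L.toAddSubgroup.relIndex (Submodule.span O (L : Set E)).toAddSubgroup := by
  rw [mul_comm]
  exact (AddSubgroup.relIndex_mul_index (H := L.toAddSubgroup)
    (K := (Submodule.span O (L : Set E)).toAddSubgroup) Submodule.subset_span).symm

end Lattice

/-! ### The normalization is the power series ring -/

section Normalization

instance inertOrder_isScalarTower (k l : Type*) [Field k] [Field l] [Algebra k l] (m : ℕ) :
    IsScalarTower (inertOrder k l m) l⟦X⟧ l⸨X⸩ :=
  IsScalarTower.of_algebraMap_eq fun _ => rfl

variable (k l : Type*) [Field k] [Field l] [Algebra k l] [FiniteDimensional k l]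

/-- Split f as its constant term plus a multiple of X: the latter lies in the order, and the former
is algebraic over k. -/
theorem isIntegral_inertOrder_powerSeries (f : l⟦X⟧) : IsIntegral (inertOrder k l 1) f := by
  obtain ⟨g, hg⟩ : (PowerSeries.X : l⟦X⟧) ∣ f - PowerSeries.C (PowerSeries.constantCoeff f) := by
    rw [PowerSeries.X_dvd_iff]
    simp
  rw [← sub_add_cancel f (PowerSeries.C (PowerSeries.constantCoeff f)), hg]
  refine IsIntegral.add ?_ ?_
  · exact isIntegral_algebraMap (x := (⟨_, X_mul_mem_inertOrder g⟩ : inertOrder k l 1))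
  · exact (Algebra.IsIntegral.isIntegral (R := k) (PowerSeries.constantCoeff f)).map_of_comp_eq
      (((PowerSeries.C (R := l)).comp (algebraMap k l)).codRestrict (inertOrder k l 1)
        C_algebraMap_mem_inertOrder) PowerSeries.C rfl

theorem mem_inertNormalization_iff {f : l⸨X⸩} :
    f ∈ inertNormalization k l 1 ↔ ∃ g : l⟦X⟧, algebraMap l⟦X⟧ l⸨X⸩ g = f := by
  constructor
  · intro hf
    have hf' : IsIntegral (inertOrder k l 1) f := hf
    exact IsIntegrallyClosed.isIntegral_iff.1 (hf'.tower_top (A := l⟦X⟧))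
  · rintro ⟨g, rfl⟩
    exact (isIntegral_inertOrder_powerSeries k l g).algebraMap

/-- The normalization of the inert order is `l⟦X⟧`. -/
noncomputable def powerSeriesEquivInertNormalization :
    l⟦X⟧ ≃ₗ[inertOrder k l 1] inertNormalization k l 1 :=
  LinearEquiv.ofBijective
    (((IsScalarTower.toAlgHom (inertOrder k l 1) l⟦X⟧ l⸨X⸩).codRestrict (inertNormalization k l 1)
      fun g => (mem_inertNormalization_iff k l).2 ⟨g, rfl⟩).toLinearMap) ⟨fun f g h =>
        IsFractionRing.injective l⟦X⟧ l⸨X⸩ (congrArg Subtype.val h), fun f => by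
        obtain ⟨g, hg⟩ := (mem_inertNormalization_iff k l).1 f.2
        exact ⟨g, Subtype.ext hg⟩⟩

end Normalization

theorem ArithmeticFunction.finset_sum_apply {ι R : Type*} [AddCommMonoid R] (s : Finset ι)
    (f : ι → ArithmeticFunction R) (n : ℕ) : (∑ i ∈ s, f i) n = ∑ i ∈ s, f i n :=
  map_sum (⟨⟨fun g => g n, rfl⟩, fun _ _ => rfl⟩ : ArithmeticFunction R →+ R) f s

/-! ### The zeta function over the inert order -/

section InertZeta

variable (k l : Type*) [Field k] [Field l] [Algebra k l]

/-- The right-hand side does not involve M: every finite-index lattice carries the same fibre, which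
makes the zeta function a product. -/
theorem card_span_eq {n c : ℕ} (M : Submodule l⟦X⟧ (Fin n → l⟦X⟧))
    (hM : Nat.card ((Fin n → l⟦X⟧) ⧸ M) ≠ 0) :
    Nonempty ({L : Submodule (inertOrder k l 1) (Fin n → l⟦X⟧) //
      Submodule.span l⟦X⟧ (L : Set (Fin n → l⟦X⟧)) = M ∧ L.toAddSubgroup.relIndex
        (Submodule.span l⟦X⟧ (L : Set (Fin n → l⟦X⟧))).toAddSubgroup = c} ≃
    {W : Submodule k (Fin n → l) //
      Submodule.span l (W : Set (Fin n → l)) = ⊤ ∧ Nat.card ((Fin n → l) ⧸ W) = c}) := by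
  obtain ⟨j, hj, rfl⟩ := exists_linearMap_range_eq n M hM
  exact ⟨(spanEqRangeEquiv (inertOrder k l 1) j hj c).trans (spanTopEquiv k l n c)⟩

/-- The index of W is q to its codimension, so only powers of q contribute, each with the count of
part (a). -/
theorem card_spanTop [Finite k] {q : ℕ} (hk : Nat.card k = q) (h2 : Module.finrank k l = 2)
    (n : ℕ) {c : ℕ} (hc : c ≠ 0) :
    (Nat.card {W : Submodule k (Fin n → l) //
      Submodule.span l (W : Set (Fin n → l)) = ⊤ ∧ Nat.card ((Fin n → l) ⧸ W) = c} : ℚ) =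
    (∑ r ∈ Finset.range (n + 1), dirTerm (productSide (q : ℚ) n r) 1 * dirTerm 1 q ^ r) c := by
  have : Module.Finite k l := Module.finite_of_finrank_pos (by omega)
  have hq1 : 1 < q := hk ▸ Finite.one_lt_card
  have hsum : (∑ r ∈ Finset.range (n + 1), dirTerm (productSide (q : ℚ) n r) 1 * dirTerm 1 q ^ r) c
      = ∑ r ∈ Finset.range (n + 1), if c = q ^ r then productSide (q : ℚ) n r else 0 := by
    rw [ArithmeticFunction.finset_sum_apply]
    refine Finset.sum_congr rfl fun r _ => ?_
    rw [dirTerm_one_pow (by omega), dirTerm_mul_dirTerm _ _ one_ne_zero, dirTerm_apply, if_neg hc,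
      one_mul, mul_one]
  have hcard : ∀ W : Submodule k (Fin n → l), Nat.card ((Fin n → l) ⧸ W) =
      q ^ Module.finrank k ((Fin n → l) ⧸ W) := fun W => by
    rw [Module.natCard_eq_pow_finrank (K := k), hk]
  rw [hsum]
  by_cases h : ∃ r, c = q ^ r
  · obtain ⟨r, rfl⟩ := h
    have hinj : ∀ s, q ^ r = q ^ s ↔ r = s := fun s =>
      (Nat.pow_right_injective hq1).eq_iff
    simp only [hinj]
    rw [Finset.sum_ite_eq]
    have hset : Nat.card {W : Submodule k (Fin n → l) //
        Submodule.span l (W : Set (Fin n → l)) = ⊤ ∧ Nat.card ((Fin n → l) ⧸ W) = q ^ r} =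
        (spanningSubspaces k l n r).ncard := by
      rw [← Nat.card_coe_set_eq]
      refine Nat.card_congr (Equiv.subtypeEquivRight fun W => ?_)
      rw [hcard, eq_comm (b := q ^ r), hinj, and_comm, eq_comm (a := r)]
      rfl
    rw [hset, ncard_spanningSubspaces k l hk h2]
    split_ifs with hr
    · rfl
    -- Codimensions above n fall outside the sum, and there the product formula gives 0.
    · exact productSide_of_lt (by positivity) (by simpa using hr)
  · rw [Finset.sum_eq_zero fun r _ => if_neg fun hr => h ⟨r, hr⟩]
    have : IsEmpty {W : Submodule k (Fin n → l) //
        Submodule.span l (W : Set (Fin n → l)) = ⊤ ∧ Nat.card ((Fin n → l) ⧸ W) = c} :=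
      ⟨fun W => h ⟨_, W.2.2.symm.trans (hcard W.1)⟩⟩
    rw [Nat.card_of_isEmpty, Nat.cast_zero]

theorem quotZeta_inertOrder_powerSeries [Finite k] {q : ℕ} (hk : Nat.card k = q)
    (h2 : Module.finrank k l = 2) (n : ℕ) :
    QuotZetaWellDefined (inertOrder k l 1) (Fin n → l⟦X⟧) ∧
      quotZeta (inertOrder k l 1) (Fin n → l⟦X⟧) = quotZeta l⟦X⟧ (Fin n → l⟦X⟧) *
        ∑ r ∈ Finset.range (n + 1), dirTerm (productSide (q : ℚ) n r) 1 * dirTerm 1 q ^ r := by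
  have : Module.Finite k l := Module.finite_of_finrank_pos (by omega)
  have : Finite l := Module.finite_of_finite k
  have hO := (qPoch_mul_quotZeta_powerSeries_pi (l := l) n).1
  have key := fun (m : ℕ) (hm : m ≠ 0) => card_fibration
    (fun L : Submodule (inertOrder k l 1) (Fin n → l⟦X⟧) =>
      Submodule.span l⟦X⟧ (L : Set (Fin n → l⟦X⟧)))
    (fun L => Nat.card ((Fin n → l⟦X⟧) ⧸ L))
    (fun L => L.toAddSubgroup.relIndex
      (Submodule.span l⟦X⟧ (L : Set (Fin n → l⟦X⟧))).toAddSubgroup)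
    (fun M => Nat.card ((Fin n → l⟦X⟧) ⧸ M))
    (card_quotient_eq_mul_relIndex (inertOrder k l 1)) (h := fun _ => 1)
    (s := fun c => Nat.card {W : Submodule k (Fin n → l) //
      Submodule.span l (W : Set (Fin n → l)) = ⊤ ∧ Nat.card ((Fin n → l) ⧸ W) = c})
    (fun m hm => (hO m hm).to_subtype) (fun M c hM _ => by
      obtain ⟨e⟩ := card_span_eq k l (c := c) M hM
      exact ⟨Finite.of_equiv _ e.symm, by rw [Nat.card_congr e, one_mul]⟩) hm
  refine ⟨fun m hm => @Set.toFinite _ _ (key m hm).1, ?_⟩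
  ext m
  rcases eq_or_ne m 0 with rfl | hm
  · simp
  rw [quotZeta_apply _ _ hm, (key m hm).2, ArithmeticFunction.mul_apply, Nat.cast_sum]
  refine Finset.sum_congr rfl fun p hp => ?_
  have hp' : p.1 * p.2 ≠ 0 := by
    rw [(Nat.mem_divisorsAntidiagonal.1 hp).1]
    exact hm
  rw [← card_spanTop k l hk h2 n (right_ne_zero_of_mul hp'),
    quotZeta_apply _ _ (left_ne_zero_of_mul hp'), one_mul, Nat.cast_mul]

theorem qPoch_mul_quotZeta_inertNormalization [Finite k] {q : ℕ} (hk : Nat.card k = q)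
    (h2 : Module.finrank k l = 2) (n : ℕ) :
    QuotZetaWellDefined (inertOrder k l 1) (Fin n → inertNormalization k l 1) ∧
      qPoch (dirTerm 1 (q ^ 2)) (dirTerm ((q : ℚ) ^ 2) 1) n *
          quotZeta (inertOrder k l 1) (Fin n → inertNormalization k l 1) =
        ∑ r ∈ Finset.range (n + 1),
          dirTerm (productSide (q : ℚ) n r) 1 * dirTerm 1 q ^ r := by
  have : Module.Finite k l := Module.finite_of_finrank_pos (by omega)
  have : Finite l := Module.finite_of_finite k
  have hl : Nat.card l = q ^ 2 := by rw [Module.natCard_eq_pow_finrank (K := k), hk, h2]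
  have e : (Fin n → inertNormalization k l 1) ≃ₗ[inertOrder k l 1] (Fin n → l⟦X⟧) :=
    LinearEquiv.piCongrRight fun _ => (powerSeriesEquivInertNormalization k l).symm
  obtain ⟨h3, h4⟩ := quotZeta_inertOrder_powerSeries k l hk h2 n
  refine ⟨e.quotZetaWellDefined h3, ?_⟩
  have h5 := (qPoch_mul_quotZeta_powerSeries_pi (l := l) n).2
  rw [hl, Nat.cast_pow] at h5
  rw [e.quotZeta_eq, h4, ← mul_assoc, h5, one_mul]

end InertZeta

theorem mainTheorem4 :
    (∀ n r : ℕ, ∃ P : Polynomial ℤ,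
      Polynomial.aeval (RatFunc.X : RatFunc ℚ) P = productSide (RatFunc.X : RatFunc ℚ) n r ∧
      Polynomial.aeval (RatFunc.X : RatFunc ℚ) P = sumSide (RatFunc.X : RatFunc ℚ) n r) ∧
    (∀ (k l : Type*) [Field k] [Field l] [Finite k] [Algebra k l] (q : ℕ),
      Nat.card k = q → Module.finrank k l = 2 →
      (∀ n r : ℕ,
        ((spanningSubspaces k l n r).ncard : ℚ) = productSide (q : ℚ) n r ∧
        ((spanningSubspaces k l n r).ncard : ℚ) = sumSide (q : ℚ) n r) ∧
      (∀ n : ℕ,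
        QuotZetaWellDefined (inertOrder k l 1) (Fin n → inertNormalization k l 1) ∧
        qPoch (dirTerm 1 (q ^ 2)) (dirTerm ((q : ℚ) ^ 2) 1) n *
            quotZeta (inertOrder k l 1) (Fin n → inertNormalization k l 1) =
          ∑ r ∈ Finset.range (n + 1),
            dirTerm (productSide (q : ℚ) n r) 1 * dirTerm 1 q ^ r)) := by 
  refine ⟨fun n r => ?_, fun k l _ _ _ _ q hk h2 => ⟨fun n r => ?_, fun n =>
    qPoch_mul_quotZeta_inertNormalization k l hk h2 n⟩⟩
  -- X is transcendental over ℚ, so an equality at X in ℚ(X) of values of integer polynomials is an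
  -- identity in ℤ[q].
  · have hq := fun (m : ℕ) (hm : m ≠ 0) => RatFunc.X_pow_ne_one (K := ℚ) hm
    obtain ⟨P, hP⟩ := exists_aeval_eq_productSide RatFunc.X_ne_zero hq n r
    exact ⟨P, hP, hP.trans (sumSide_eq_productSide RatFunc.X_ne_zero hq n r).symm⟩
  · have hq1 : 1 < q := hk ▸ Finite.one_lt_card
    have h := ncard_spanningSubspaces k l hk h2 n r
    exact ⟨h, h.trans (sumSide_eq_productSide (by positivity) (fun m hm =>
      (one_lt_pow₀ (by exact_mod_cast hq1) hm).ne') n r).symm⟩
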